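/- Let $r\ge 0$ be an integer and let $\Bbbk$ be a commutative ring with unit. Let $Q_{r+1}=\{0,1\}^{r+1}$ carry the Hamming distance, let $\overline{n}$ denote the binary string obtained from $n\in Q_{r+1}$ by switching all its entries, and let $VR(Q_{r+1};r)$ be the simplicial complex whose simplices are the nonempty subsets of $Q_{r+1}$ of diameter at most $r$. For $J\subseteq Q_{r+1}$ let $K_J$ denote the full subcomplex of $K=VR(Q_{r+1};r)$ on $J$, and let $\Sigma$ denote the unreduced suspension, with the convention $\Sigma K_\emptyset=S^0$. For disjoint $J,L$, the $*$-product $$\widetilde H^{p}(\Sigma K_J;\Bbbk)\otimes_{\Bbbk} \widetilde H^{q}(\Sigma K_L;\Bbbk)\longrightarrow\widetilde H^{p+q}(\Sigma K_{J\cup L};\Bbbk)$$ is the map that corresponds, under the suspension isomorphisms $\widetilde H^{i}(\Sigma X;\Bbbk)\cong\widetilde H^{i-1}(X;\Bbbk)$, to the external product $\widetilde H^{p-1}(K_J;\Bbbk)\otimes_{\Bbbk}\widetilde H^{q-1}(K_L;\Bbbk)\to\widetilde H^{p+q-1}(K_J*K_L;\Bbbk)$ with values in the reduced simplicial cohomology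 of the join, followed by restriction along the inclusion $K_{J\cup L}\subseteq K_J*K_L$. (1) If $J=\{n_1,\overline{n}_1,\ldots,n_j,\overline{n}_j\}$ with the $2j$ vertices $n_i,\overline{n}_i$ pairwise distinct ($j\ge 0$), then $\Sigma K_J\simeq S^{j}$. (2) If $J\subseteq Q_{r+1}$ is not of the form in (1) for any $j\ge 0$, then $\Sigma K_J$ is contractible. (3) If $J=\{n_1,\overline{n}_1,\ldots,n_j,\overline{n}_j\}$ and $L=\{m_1,\overline{m}_1,\ldots,m_s,\overline{m}_s\}$ with all the vertices $n_i,\overline{n}_i,m_i,\overline{m}_i$ pairwise distinct, then $\widetilde H^{j}(\Sigma K_J;\Bbbk)$, $\widetilde H^{s}(\Sigma K_L;\Bbbk)$ and $\widetilde H^{j+s}(\Sigma K_{J\cup L};\Bbbk)$ are isomorphic to $\Bbbk$, and these isomorphisms can be chosen so that the $*$-product $$\widetilde H^{j}(\Sigma K_J;\Bbbk)\otimes_{\Bbbk} \widetilde H^{s}(\Sigma K_L;\Bbbk)\longrightarrow\widetilde H^{j+s}(\Sigma K_{J\cup L};\Bbbk)$$ becomes the multiplication isomorphism $\Bbbk\otimes_{\Bbbk}\Bbbk\to\Bbbk$.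 -/

import Mathlib

set_option linter.unusedSectionVars false

noncomputable section

namespace VRCube

/-! ### The hypercube and its Vietoris–Rips complexes -/

/-- Vertices of the `n`-dimensional hypercube: binary strings of length `n`. -/
def Q (n : ℕ) : Type := Fin n → Bool

instance (n : ℕ) : Fintype (Q n) := inferInstanceAs (Fintype (Fin n → Bool))

/-- The lexicographic order on binary strings, that is, the numerical order on the integers
`0, …, 2 ^ n - 1` written in binary. It only serves to orient simplices. -/
instance (n : ℕ) : LinearOrder (Q n) := inferInstanceAs (LinearOrder (Lex (Fin n → Bool)))

/-- The Hamming distance on the vertices of the hypercube. -/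
def hamming {n : ℕ} (a b : Q n) : ℕ := hammingDist (β := fun _ : Fin n => Bool) a b

/-- The string obtained by switching all the entries. -/
def antipode {n : ℕ} (a : Q n) : Q n := fun i => !(a i)

/-- The Vietoris–Rips complex `VR(Q_n; r)`: the nonempty sets of vertices of diameter at most
`r` for the Hamming distance. -/
def VR (n r : ℕ) : PreAbstractSimplicialComplex (Q n) where
  faces := {σ | σ.Nonempty ∧ ∀ a ∈ σ, ∀ b ∈ σ, hamming a b ≤ r}
  isRelLowerSet_faces := fun {_} hσ =>
    ⟨hσ.1, fun _ hts ht => ⟨ht, fun a ha b hb => hσ.2 a (hts ha) b (hts hb)⟩⟩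

/-- `J = {v₁, v̄₁, …, v_j, v̄_j}` with the `2 j` vertices `v_i`, `v̄_i` pairwise distinct. -/
def IsAntipodalUnion {n : ℕ} (J : Finset (Q n)) (j : ℕ) : Prop :=
  ∃ v : Fin j → Q n,
    Function.Injective (Sum.elim v (fun i => antipode (v i))) ∧
      ∀ x, x ∈ J ↔ ∃ i, x = v i ∨ x = antipode (v i)

/-! ### Geometric realization and topological suspension -/

/-- The full subcomplex `K_J`. -/
def full {V : Type*} (K : PreAbstractSimplicialComplex V) (J : Finset V) :
    PreAbstractSimplicialComplex V where
  faces := {σ | σ ∈ K.faces ∧ σ ⊆ J}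
  isRelLowerSet_faces := fun {_} hσ =>
    ⟨(K.isRelLowerSet_faces hσ.1).1, fun _ hts ht =>
      ⟨(K.isRelLowerSet_faces hσ.1).2 hts ht, hts.trans hσ.2⟩⟩

/-- The geometric realization of a simplicial complex on a finite vertex type, in barycentric
coordinates, with the subspace topology. -/
def Realization {V : Type*} [Fintype V] (K : PreAbstractSimplicialComplex V) : Type _ :=
  {x : V → ℝ // x ∈ stdSimplex ℝ V ∧ ∃ σ ∈ K.faces, ∀ v, x v ≠ 0 → v ∈ σ}

instance {V : Type*} [Fintype V] (K : PreAbstractSimplicialComplex V) :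
    TopologicalSpace (Realization K) :=
  inferInstanceAs (TopologicalSpace
    {x : V → ℝ // x ∈ stdSimplex ℝ V ∧ ∃ σ ∈ K.faces, ∀ v, x v ≠ 0 → v ∈ σ})

/-- The gluing relation of the suspension: one end of the cylinder `X × [0, 1]` is collapsed to
one pole and the other end to the other pole. -/
inductive SuspensionRel (X : Type*) : (X × unitInterval) ⊕ Bool → (X × unitInterval) ⊕ Bool → Prop
  | south (x : X) : SuspensionRel X (Sum.inl (x, 0)) (Sum.inr false)
  | north (x : X) : SuspensionRel X (Sum.inl (x, 1)) (Sum.inr true)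

/-- The unreduced suspension of a space `X`: the cylinder `X × [0, 1]` together with two poles,
the two ends of the cylinder being glued to the two poles. The suspension of the empty space
consists of the two poles, i.e. it is `S⁰`. -/
def Suspension (X : Type*) : Type _ := Quot (SuspensionRel X)

instance (X : Type*) [TopologicalSpace X] : TopologicalSpace (Suspension X) :=
  inferInstanceAs (TopologicalSpace (Quot (SuspensionRel X)))

/-- The standard sphere `S^j`. -/
abbrev Sphere (j : ℕ) : Type := Metric.sphere (0 : EuclideanSpace ℝ (Fin (j + 1))) 1

/-! ### Reduced simplicial cohomology -/

theorem aug_mono {V : Type*} {K : PreAbstractSimplicialComplex V} {σ τ : Finset V}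
    (hσ : σ = ∅ ∨ σ ∈ K.faces) (h : τ ⊆ σ) : τ = ∅ ∨ τ ∈ K.faces := by
  rcases τ.eq_empty_or_nonempty with rfl | hne
  · exact Or.inl rfl
  · rcases hσ with rfl | hσ
    · exact Or.inl (Finset.subset_empty.mp h)
    · exact Or.inr ((K.isRelLowerSet_faces hσ).2 h hne)

section Cohomology

variable {V : Type*} [LinearOrder V]

/-- The simplices of `K` together with the empty simplex, as in the augmented cochain complex. -/
abbrev AugFace (K : PreAbstractSimplicialComplex V) : Type _ :=
  {σ : Finset V // σ = ∅ ∨ σ ∈ K.faces}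

/-- The face of `σ` opposite to the vertex `v`. -/
def AugFace.erase {K : PreAbstractSimplicialComplex V} (σ : AugFace K) (v : V) : AugFace K :=
  ⟨σ.1.erase v, aug_mono σ.2 (Finset.erase_subset v σ.1)⟩

/-- The number of vertices of `σ` that precede `v`. -/
def pos (σ : Finset V) (v : V) : ℕ := (σ.filter (· < v)).card

variable (k : Type*) [CommRing k]

/-- All cochains on the simplices of `K` (including the empty one). A cochain is given by its values
on simplices with the orientation coming from the order of the vertices. -/
abbrev Cochain (K : PreAbstractSimplicialComplex V) : Type _ := AugFace K → k

/-- Cochains supported on simplices with `q` vertices, i.e. of dimension `q - 1`. -/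
def homogeneous (K : PreAbstractSimplicialComplex V) (q : ℕ) : Submodule k (Cochain k K) where
  carrier := {φ | ∀ σ, σ.1.card ≠ q → φ σ = 0}
  add_mem' := fun ha hb σ h => by simp [ha σ h, hb σ h]
  zero_mem' := fun _ _ => rfl
  smul_mem' := fun c _ ha σ h => by simp [ha σ h]

/-- The simplicial coboundary
`(dφ)[v₀, …, v_q] = ∑ᵢ (-1)ⁱ φ[v₀, …, v̂ᵢ, …, v_q]` for `v₀ < ⋯ < v_q`. -/
def d (K : PreAbstractSimplicialComplex V) : Cochain k K →ₗ[k] Cochain k K where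
  toFun φ σ := ∑ v ∈ σ.1, (-1 : k) ^ pos σ.1 v * φ (σ.erase v)
  map_add' φ ψ := by
    funext σ
    simp [mul_add, Finset.sum_add_distrib]
  map_smul' c φ := by
    funext σ
    simp [Finset.mul_sum, mul_left_comm]

/-- Cocycles on simplices with `q` vertices. -/
def cocycles (K : PreAbstractSimplicialComplex V) (q : ℕ) : Submodule k (Cochain k K) :=
  homogeneous k K q ⊓ LinearMap.ker (d k K)

/-- Coboundaries on simplices with `q` vertices. -/
def coboundaries (K : PreAbstractSimplicialComplex V) : ℕ → Submodule k (Cochain k K)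
  | 0 => ⊥
  | q + 1 => (homogeneous k K q).map (d k K)

/-- `RedH k K q` is the reduced simplicial cohomology group of `K` in degree `q - 1`; the degree
`-1` is the one of the empty simplex. -/
abbrev RedH (K : PreAbstractSimplicialComplex V) (q : ℕ) : Type _ :=
  cocycles k K q ⧸ (coboundaries k K q).submoduleOf (cocycles k K q)

/-- A linear map of cochains that preserves cocycles and coboundaries acts on cohomology. -/
def RedH.map {k} [CommRing k] {W : Type*} [LinearOrder W] {K : PreAbstractSimplicialComplex V}
    {M : PreAbstractSimplicialComplex W} {p q : ℕ} (f : Cochain k K →ₗ[k] Cochain k M)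
    (hZ : ∀ φ ∈ cocycles k K p, f φ ∈ cocycles k M q)
    (hB : ∀ φ ∈ coboundaries k K p, f φ ∈ coboundaries k M q) : RedH k K p →ₗ[k] RedH k M q :=
  Submodule.mapQ _ _ (f.restrict hZ) (fun φ hφ => hB φ.1 hφ)

/-! ### Joins and the `*`-product -/

/-- The join of two simplicial complexes on the same vertex type; it is used for complexes with
disjoint vertex sets. -/
def join (K M : PreAbstractSimplicialComplex V) : PreAbstractSimplicialComplex V where
  faces := {ρ | ρ.Nonempty ∧ ∃ σ τ : Finset V,
    (σ = ∅ ∨ σ ∈ K.faces) ∧ (τ = ∅ ∨ τ ∈ M.faces) ∧ ρ = σ ∪ τ}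
  isRelLowerSet_faces := by
    rintro _ ⟨hne, σ, τ, hσ, hτ, rfl⟩
    refine ⟨hne, fun ρ hρ hne' => ⟨hne', ρ ∩ σ, ρ ∩ τ, aug_mono hσ Finset.inter_subset_right,
      aug_mono hτ Finset.inter_subset_right, ?_⟩⟩
    rw [← Finset.inter_union_distrib_left, Finset.inter_eq_left.mpr hρ]

theorem aug_full_iff {K : PreAbstractSimplicialComplex V} {J σ : Finset V} :
    (σ = ∅ ∨ σ ∈ (full K J).faces) ↔ (σ = ∅ ∨ σ ∈ K.faces) ∧ σ ⊆ J := by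
  constructor
  · rintro (rfl | h)
    · exact ⟨Or.inl rfl, Finset.empty_subset _⟩
    · exact ⟨Or.inr h.1, h.2⟩
  · rintro ⟨rfl | h, h'⟩
    · exact Or.inl rfl
    · exact Or.inr ⟨h, h'⟩

theorem aug_join {K M : PreAbstractSimplicialComplex V} {ρ : Finset V}
    (h : ρ = ∅ ∨ ρ ∈ (join K M).faces) : ∃ σ τ : Finset V,
      (σ = ∅ ∨ σ ∈ K.faces) ∧ (τ = ∅ ∨ τ ∈ M.faces) ∧ ρ = σ ∪ τ := by
  rcases h with rfl | h
  · exact ⟨∅, ∅, Or.inl rfl, Or.inl rfl, by simp⟩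
  · exact h.2

section Cross

variable (K : PreAbstractSimplicialComplex V) (J L : Finset V)

theorem join_inter_left (hJL : Disjoint J L) {ρ : Finset V}
    (h : ρ = ∅ ∨ ρ ∈ (join (full K J) (full K L)).faces) :
    ρ ∩ J = ∅ ∨ ρ ∩ J ∈ (full K J).faces := by
  obtain ⟨σ, τ, hσ, hτ, rfl⟩ := aug_join h
  refine aug_mono hσ ?_
  have h2 := (aug_full_iff.mp hτ).2
  intro v hv
  rw [Finset.mem_inter, Finset.mem_union] at hv
  rcases hv with ⟨h3 | h3, h4⟩
  · exact h3
  · exact absurd (h2 h3) (Finset.disjoint_left.mp hJL h4)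

theorem join_inter_right (hJL : Disjoint J L) {ρ : Finset V}
    (h : ρ = ∅ ∨ ρ ∈ (join (full K J) (full K L)).faces) :
    ρ ∩ L = ∅ ∨ ρ ∩ L ∈ (full K L).faces := by
  obtain ⟨σ, τ, hσ, hτ, rfl⟩ := aug_join h
  refine aug_mono hτ ?_
  have h2 := (aug_full_iff.mp hσ).2
  intro v hv
  rw [Finset.mem_inter, Finset.mem_union] at hv
  rcases hv with ⟨h3 | h3, h4⟩
  · exact absurd h4 (Finset.disjoint_left.mp hJL (h2 h3))
  · exact h3

theorem join_eq_union {ρ : Finset V}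
    (h : ρ = ∅ ∨ ρ ∈ (join (full K J) (full K L)).faces) : ρ = ρ ∩ J ∪ ρ ∩ L := by
  obtain ⟨σ, τ, hσ, hτ, rfl⟩ := aug_join h
  have h1 := (aug_full_iff.mp hσ).2
  have h2 := (aug_full_iff.mp hτ).2
  rw [← Finset.inter_union_distrib_left]
  exact (Finset.inter_eq_left.mpr (Finset.union_subset_union h1 h2)).symm

/-- The number of pairs in `A × B` that are in the wrong order, i.e. the number of inversions of the
shuffle which sorts the vertices of `A` followed by those of `B`. -/
def inversions (A B : Finset V) : ℕ := ∑ a ∈ A, pos B a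

/-- The external product of cochains on the join `K_J * K_L`: an oriented simplex `σ * τ` of
the join, with the vertices of `σ` listed before those of `τ`, is sent to `φ(σ) ψ(τ)`. -/
def cross (hJL : Disjoint J L) : Cochain k (full K J) →ₗ[k] Cochain k (full K L) →ₗ[k]
    Cochain k (join (full K J) (full K L)) :=
  LinearMap.mk₂ k
    (fun φ ψ ρ => (-1 : k) ^ inversions (ρ.1 ∩ J) (ρ.1 ∩ L) *
      (φ ⟨ρ.1 ∩ J, join_inter_left K J L hJL ρ.2⟩ * ψ ⟨ρ.1 ∩ L, join_inter_right K J L hJL ρ.2⟩))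
    (fun φ φ' ψ => by funext ρ; simp only [Pi.add_apply]; ring)
    (fun c φ ψ => by funext ρ; simp only [Pi.smul_apply, smul_eq_mul]; ring)
    (fun φ ψ ψ' => by funext ρ; simp only [Pi.add_apply]; ring)
    (fun c φ ψ => by funext ρ; simp only [Pi.smul_apply, smul_eq_mul]; ring)

theorem inversions_erase_left {A B : Finset V} {v : V} (hv : v ∈ A) :
    inversions A B = pos B v + inversions (A.erase v) B :=
  (Finset.add_sum_erase A (fun a => pos B a) hv).symm

theorem pos_erase {B : Finset V} {v : V} (hv : v ∈ B) (a : V) :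
    pos B a = pos (B.erase v) a + if v < a then 1 else 0 := by
  unfold pos
  rw [Finset.filter_erase]
  split_ifs with h
  · rw [Finset.card_erase_add_one (Finset.mem_filter.mpr ⟨hv, h⟩)]
  · rw [Finset.erase_eq_of_notMem (s := B.filter (· < a))
      (fun h' => h (Finset.mem_filter.mp h').2), add_zero]

theorem inversions_erase_right {A B : Finset V} {v : V} (hvA : v ∉ A) (hv : v ∈ B) :
    inversions A B + pos A v = A.card + inversions A (B.erase v) := by
  have h1 : inversions A B = inversions A (B.erase v) + (A.filter (v < ·)).card := by
    unfold inversions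
    rw [Finset.card_filter, ← Finset.sum_add_distrib]
    exact Finset.sum_congr rfl fun a _ => pos_erase hv a
  have h2 : A.filter (v < ·) = A.filter (fun a => ¬ a < v) := by
    refine Finset.filter_congr fun a ha => ?_
    rw [not_lt]
    exact ⟨le_of_lt, fun h => lt_of_le_of_ne h (fun e => hvA (e ▸ ha))⟩
  have h3 := Finset.card_filter_add_card_filter_not (s := A) (fun a => a < v)
  rw [h1, h2]
  unfold pos
  omega

theorem pos_union {A B : Finset V} (h : Disjoint A B) (v : V) :
    pos (A ∪ B) v = pos A v + pos B v := by
  unfold pos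
  rw [Finset.filter_union, Finset.card_union_of_disjoint (Finset.disjoint_filter_filter h)]

/-- The Leibniz rule for the external product. -/
theorem d_cross (hJL : Disjoint J L) (φ : Cochain k (full K J)) (ψ : Cochain k (full K L))
    (ρ : AugFace (join (full K J) (full K L))) :
    d k _ (cross k K J L hJL φ ψ) ρ = cross k K J L hJL (d k _ φ) ψ ρ +
      (-1 : k) ^ (ρ.1 ∩ J).card * cross k K J L hJL φ (d k _ ψ) ρ := by
  obtain ⟨ρ, hρ⟩ := ρ
  have hu := join_eq_union K J L hρ
  have hd : Disjoint (ρ ∩ J) (ρ ∩ L) :=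
    hJL.mono Finset.inter_subset_right Finset.inter_subset_right
  simp only [d, cross, LinearMap.mk₂_apply, LinearMap.coe_mk, AddHom.coe_mk, AugFace.erase]
  conv_lhs => rw [show (∑ v ∈ ρ, _ : k) = ∑ v ∈ ρ ∩ J ∪ ρ ∩ L, _ from by rw [← hu]]
  rw [Finset.sum_union hd]
  congr 1
  · rw [Finset.sum_mul, Finset.mul_sum]
    refine Finset.sum_congr rfl fun v hv => ?_
    have hvL : v ∉ ρ ∩ L := Finset.disjoint_left.mp hd hv
    have e1 : ρ.erase v ∩ J = (ρ ∩ J).erase v := Finset.erase_inter v ρ J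
    have e2 : ρ.erase v ∩ L = ρ ∩ L := by
      rw [Finset.erase_inter, Finset.erase_eq_of_notMem hvL]
    have e3 : pos ρ v = pos (ρ ∩ J) v + pos (ρ ∩ L) v := by rw [← pos_union hd, ← hu]
    simp only [e1, e2, e3, inversions_erase_left hv, pow_add]
    ring
  · rw [Finset.mul_sum, Finset.mul_sum, Finset.mul_sum]
    refine Finset.sum_congr rfl fun v hv => ?_
    have hvJ : v ∉ ρ ∩ J := Finset.disjoint_right.mp hd hv
    have e1 : ρ.erase v ∩ L = (ρ ∩ L).erase v := Finset.erase_inter v ρ L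
    have e2 : ρ.erase v ∩ J = ρ ∩ J := by
      rw [Finset.erase_inter, Finset.erase_eq_of_notMem hvJ]
    have e3 : pos ρ v = pos (ρ ∩ J) v + pos (ρ ∩ L) v := by rw [← pos_union hd, ← hu]
    have e4 := inversions_erase_right hvJ hv
    have e5 : (-1 : k) ^ pos (ρ ∩ J) v * (-1 : k) ^ inversions (ρ ∩ J) ((ρ ∩ L).erase v) =
        (-1 : k) ^ (ρ ∩ J).card * (-1 : k) ^ inversions (ρ ∩ J) (ρ ∩ L) := by
      rw [← pow_add, ← pow_add]
      refine neg_one_pow_congr ?_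
      rw [Nat.even_add, Nat.even_add]
      have := congrArg Even e4
      rw [Nat.even_add, Nat.even_add] at this
      grind
    simp only [e1, e2, e3, pow_add]
    linear_combination ((-1 : k) ^ pos (ρ ∩ L) v * (φ ⟨ρ ∩ J, join_inter_left K J L hJL hρ⟩ *
      ψ ⟨(ρ ∩ L).erase v, aug_mono (join_inter_right K J L hJL hρ)
        (Finset.erase_subset _ _)⟩)) * e5

theorem cross_mem_homogeneous (hJL : Disjoint J L) {p q : ℕ} {φ : Cochain k (full K J)}
    {ψ : Cochain k (full K L)} (hφ : φ ∈ homogeneous k (full K J) p)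
    (hψ : ψ ∈ homogeneous k (full K L) q) :
    cross k K J L hJL φ ψ ∈ homogeneous k (join (full K J) (full K L)) (p + q) := by
  intro ρ hρ
  simp only [cross, LinearMap.mk₂_apply]
  have hd : Disjoint (ρ.1 ∩ J) (ρ.1 ∩ L) :=
    hJL.mono Finset.inter_subset_right Finset.inter_subset_right
  have hc : ρ.1.card = (ρ.1 ∩ J).card + (ρ.1 ∩ L).card := by
    rw [← Finset.card_union_of_disjoint hd, ← join_eq_union K J L ρ.2]
  by_cases h : (ρ.1 ∩ J).card = p
  · rw [hψ ⟨ρ.1 ∩ L, join_inter_right K J L hJL ρ.2⟩ (by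
      intro h'
      change (ρ.1 ∩ L).card = q at h'
      exact hρ (by rw [hc, h, h']))]
    simp
  · rw [hφ ⟨ρ.1 ∩ J, join_inter_left K J L hJL ρ.2⟩ h]
    simp

theorem d_cross_homogeneous (hJL : Disjoint J L) {p : ℕ} {φ : Cochain k (full K J)}
    (hφ : φ ∈ homogeneous k (full K J) p) (ψ : Cochain k (full K L)) :
    d k _ (cross k K J L hJL φ ψ) = cross k K J L hJL (d k _ φ) ψ +
      (-1 : k) ^ p • cross k K J L hJL φ (d k _ ψ) := by
  funext ρ
  rw [d_cross, Pi.add_apply, Pi.smul_apply, smul_eq_mul]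
  by_cases h : (ρ.1 ∩ J).card = p
  · rw [h]
  · have : cross k K J L hJL φ (d k _ ψ) ρ = 0 := by
      simp only [cross, LinearMap.mk₂_apply]
      rw [hφ ⟨ρ.1 ∩ J, join_inter_left K J L hJL ρ.2⟩ h]
      simp
    rw [this, mul_zero, mul_zero]

theorem cross_mem_cocycles (hJL : Disjoint J L) {p q : ℕ} {φ : Cochain k (full K J)}
    {ψ : Cochain k (full K L)} (hφ : φ ∈ cocycles k (full K J) p)
    (hψ : ψ ∈ cocycles k (full K L) q) :
    cross k K J L hJL φ ψ ∈ cocycles k (join (full K J) (full K L)) (p + q) := by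
  refine ⟨cross_mem_homogeneous k K J L hJL hφ.1 hψ.1, LinearMap.mem_ker.mpr ?_⟩
  rw [d_cross_homogeneous k K J L hJL hφ.1, LinearMap.mem_ker.mp hφ.2,
    LinearMap.mem_ker.mp hψ.2]
  simp

theorem cross_mem_coboundaries_left (hJL : Disjoint J L) {p q : ℕ} {φ : Cochain k (full K J)}
    {ψ : Cochain k (full K L)} (hφ : φ ∈ coboundaries k (full K J) p)
    (hψ : ψ ∈ cocycles k (full K L) q) :
    cross k K J L hJL φ ψ ∈ coboundaries k (join (full K J) (full K L)) (p + q) := by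
  cases p with
  | zero =>
    rw [show φ = 0 from hφ, map_zero, LinearMap.zero_apply]
    exact Submodule.zero_mem _
  | succ p =>
    obtain ⟨η, hη, rfl⟩ := hφ
    rw [Nat.add_right_comm]
    refine ⟨cross k K J L hJL η ψ, cross_mem_homogeneous k K J L hJL hη hψ.1, ?_⟩
    rw [d_cross_homogeneous k K J L hJL hη, LinearMap.mem_ker.mp hψ.2]
    simp

theorem cross_mem_coboundaries_right (hJL : Disjoint J L) {p q : ℕ} {φ : Cochain k (full K J)}
    {ψ : Cochain k (full K L)} (hφ : φ ∈ cocycles k (full K J) p)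
    (hψ : ψ ∈ coboundaries k (full K L) q) :
    cross k K J L hJL φ ψ ∈ coboundaries k (join (full K J) (full K L)) (p + q) := by
  cases q with
  | zero =>
    rw [show ψ = 0 from hψ, map_zero]
    exact Submodule.zero_mem _
  | succ q =>
    obtain ⟨η, hη, rfl⟩ := hψ
    refine ⟨(-1 : k) ^ p • cross k K J L hJL φ η,
      Submodule.smul_mem _ _ (cross_mem_homogeneous k K J L hJL hφ.1 hη), ?_⟩
    rw [map_smul, d_cross_homogeneous k K J L hJL hφ.1, LinearMap.mem_ker.mp hφ.2, map_zero,
      LinearMap.zero_apply, zero_add, smul_smul, ← mul_pow]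
    simp

/-- The external product
`H̃^{p-1}(K_J) ⊗ H̃^{q-1}(K_L) → H̃^{p+q-1}(K_J * K_L)`. -/
def crossH (hJL : Disjoint J L) (p q : ℕ) : RedH k (full K J) p →ₗ[k] RedH k (full K L) q →ₗ[k]
    RedH k (join (full K J) (full K L)) (p + q) :=
  let f : cocycles k (full K J) p →ₗ[k] cocycles k (full K L) q →ₗ[k]
      RedH k (join (full K J) (full K L)) (p + q) :=
    LinearMap.mk₂ k
      (fun φ ψ => Submodule.Quotient.mk
        ⟨cross k K J L hJL φ.1 ψ.1, cross_mem_cocycles k K J L hJL φ.2 ψ.2⟩)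
      (fun φ φ' ψ => by rw [← Submodule.Quotient.mk_add]; congr 1; ext1; simp)
      (fun c φ ψ => by rw [← Submodule.Quotient.mk_smul]; congr 1; ext1; simp)
      (fun φ ψ ψ' => by rw [← Submodule.Quotient.mk_add]; congr 1; ext1; simp)
      (fun c φ ψ => by rw [← Submodule.Quotient.mk_smul]; congr 1; ext1; simp)
  Submodule.liftQ _
    (LinearMap.flip (Submodule.liftQ _ f.flip (fun ψ hψ => LinearMap.ext fun φ =>
      (Submodule.Quotient.mk_eq_zero _).mpr
        (cross_mem_coboundaries_right k K J L hJL φ.2 hψ))))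
    (fun φ hφ => LinearMap.ext fun b => by
      induction b using Submodule.Quotient.induction_on with
      | H ψ =>
        exact (Submodule.Quotient.mk_eq_zero _).mpr
          (cross_mem_coboundaries_left k K J L hJL hφ ψ.2))

/-- Restriction of cochains to a subcomplex. -/
def restrict {M N : PreAbstractSimplicialComplex V} (h : M ≤ N) : Cochain k N →ₗ[k] Cochain k M :=
  LinearMap.funLeft k k (fun σ => ⟨σ.1, σ.2.imp id (fun hσ => h hσ)⟩)

/-- The map induced in reduced cohomology by the inclusion of a subcomplex. -/
def restrictH {M N : PreAbstractSimplicialComplex V} (h : M ≤ N) (q : ℕ) :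
    RedH k N q →ₗ[k] RedH k M q :=
  have hd : ∀ φ : Cochain k N, d k M (restrict k h φ) = restrict k h (d k N φ) := fun _ => rfl
  have hh : ∀ q, ∀ φ ∈ homogeneous k N q, restrict k h φ ∈ homogeneous k M q :=
    fun _ _ hφ σ hσ => hφ ⟨σ.1, σ.2.imp id (fun hσ => h hσ)⟩ hσ
  RedH.map (restrict k h)
    (fun φ hφ => ⟨hh q φ hφ.1, by
      refine LinearMap.mem_ker.mpr ?_
      rw [hd, LinearMap.mem_ker.mp hφ.2, map_zero]⟩)
    (fun φ hφ => by
      cases q with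
      | zero =>
        rw [show φ = 0 from hφ, map_zero]
        exact Submodule.zero_mem _
      | succ q =>
        obtain ⟨η, hη, rfl⟩ := hφ
        exact ⟨restrict k h η, hh q η hη, hd η⟩)

/-- The inclusion `K_{J ∪ L} ⊆ K_J * K_L`. -/
theorem full_union_le_join : full K (J ∪ L) ≤ join (full K J) (full K L) := by
  intro ρ hρ
  have hne := (K.isRelLowerSet_faces hρ.1).1
  refine ⟨hne, ρ ∩ J, ρ ∩ L, ?_, ?_, ?_⟩
  · exact aug_full_iff.mpr ⟨aug_mono (Or.inr hρ.1) Finset.inter_subset_left,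
      Finset.inter_subset_right⟩
  · exact aug_full_iff.mpr ⟨aug_mono (Or.inr hρ.1) Finset.inter_subset_left,
      Finset.inter_subset_right⟩
  · rw [← Finset.inter_union_distrib_left, Finset.inter_eq_left.mpr hρ.2]

/-- The `*`-product
`H̃^{p-1}(K_J) ⊗ H̃^{q-1}(K_L) → H̃^{p+q-1}(K_{J ∪ L})` for disjoint `J` and `L`: the
external product followed by the map induced by the inclusion `K_{J ∪ L} ⊆ K_J * K_L`. -/
def star (hJL : Disjoint J L) (p q : ℕ) : RedH k (full K J) p →ₗ[k] RedH k (full K L) q →ₗ[k]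
    RedH k (full K (J ∪ L)) (p + q) :=
  (crossH k K J L hJL p q).compr₂ (restrictH k (full_union_le_join K J L) (p + q))

end Cross

/-! ### The suspension of a simplicial complex -/

section Susp

/-- The vertices of the suspension: two poles and the given vertices. -/
inductive SuspVertex.{u} (V : Type u) : Type u
  | pole (b : Bool) : SuspVertex V
  | base (v : V) : SuspVertex V

/-- The poles are placed before the other vertices. -/
instance : LinearOrder (SuspVertex V) :=
  LinearOrder.lift'
    (fun x : SuspVertex V => match x with
      | .pole b => (toLex (Sum.inl b) : Bool ⊕ₗ V)
      | .base v => (toLex (Sum.inr v) : Bool ⊕ₗ V))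
    (by
      rintro (b | v) (c | w) h
      · exact congrArg _ (Sum.inl_injective (toLex_inj.mp h))
      · exact absurd (toLex_inj.mp h) (by simp)
      · exact absurd (toLex_inj.mp h) (by simp)
      · exact congrArg _ (Sum.inr_injective (toLex_inj.mp h)))

theorem SuspVertex.pole_lt_base (b : Bool) (v : V) : pole b < base v :=
  Sum.Lex.inl_lt_inr b v

theorem SuspVertex.base_lt_base {v w : V} : base v < base w ↔ v < w :=
  Sum.Lex.inr_lt_inr_iff

/-- The vertices of the simplex `ω` that are not poles. -/
def basePart (ω : Finset (SuspVertex V)) : Finset V :=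
  ω.preimage SuspVertex.base (fun _ _ _ _ h => SuspVertex.base.inj h)

theorem mem_basePart {ω : Finset (SuspVertex V)} {v : V} :
    v ∈ basePart ω ↔ SuspVertex.base v ∈ ω := Finset.mem_preimage

/-- The suspension `ΣK = S⁰ * K` of a simplicial complex: the join of `K` with two points, the
poles `SuspVertex.pole b`. -/
def susp (K : PreAbstractSimplicialComplex V) : PreAbstractSimplicialComplex (SuspVertex V) where
  faces := {ω | ω.Nonempty ∧
    ¬ (SuspVertex.pole false ∈ ω ∧ SuspVertex.pole true ∈ ω) ∧
    (basePart ω = ∅ ∨ basePart ω ∈ K.faces)}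
  isRelLowerSet_faces := by
    rintro ω ⟨h1, h2, h3⟩
    refine ⟨h1, fun ω' hω' hne => ⟨hne, fun h => h2 ⟨hω' h.1, hω' h.2⟩, aug_mono h3 ?_⟩⟩
    intro v hv
    exact mem_basePart.mpr (hω' (mem_basePart.mp hv))

variable {K : PreAbstractSimplicialComplex V}

theorem aug_susp_iff {ω : Finset (SuspVertex V)} : (ω = ∅ ∨ ω ∈ (susp K).faces) ↔
    ¬ (SuspVertex.pole false ∈ ω ∧ SuspVertex.pole true ∈ ω) ∧
    (basePart ω = ∅ ∨ basePart ω ∈ K.faces) := by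
  constructor
  · rintro (rfl | h)
    · exact ⟨by simp, Or.inl (by ext; simp [basePart])⟩
    · exact h.2
  · intro h
    rcases ω.eq_empty_or_nonempty with h0 | h0
    · exact Or.inl h0
    · exact Or.inr ⟨h0, h⟩

/-- The inclusion of the vertices of `K` in those of `ΣK`. -/
def baseEmb : V ↪ SuspVertex V :=
  ⟨SuspVertex.base, fun _ _ h => SuspVertex.base.inj h⟩

theorem baseEmb_apply (v : V) : baseEmb v = SuspVertex.base v := rfl

theorem basePart_map (σ : Finset V) : basePart (σ.map baseEmb) = σ := by
  ext v
  simp [mem_basePart, baseEmb_apply]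

theorem basePart_insert (b : Bool) (σ : Finset V) :
    basePart (insert (SuspVertex.pole b) (σ.map baseEmb)) = σ := by
  ext v
  simp [mem_basePart, baseEmb_apply]

theorem pole_notMem_map (b : Bool) (σ : Finset V) :
    SuspVertex.pole b ∉ σ.map baseEmb := by
  simp [baseEmb_apply]

/-- A simplex of `K`, seen in `ΣK`. -/
def base (σ : AugFace K) : AugFace (susp K) :=
  ⟨σ.1.map baseEmb, aug_susp_iff.mpr ⟨fun h => pole_notMem_map _ _ h.1, by
    rw [basePart_map]; exact σ.2⟩⟩

/-- The simplex of `ΣK` spanned by a pole and a simplex of `K`. -/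
def cone (b : Bool) (σ : AugFace K) : AugFace (susp K) :=
  ⟨insert (SuspVertex.pole b) (σ.1.map baseEmb), aug_susp_iff.mpr
    ⟨by cases b <;> simp [baseEmb_apply], by rw [basePart_insert]; exact σ.2⟩⟩

theorem susp_cases (ω : AugFace (susp K)) : (∃ σ, ω = base σ) ∨ ∃ b σ, ω = cone b σ := by
  obtain ⟨ω, hω⟩ := ω
  obtain ⟨h1, h2⟩ := aug_susp_iff.mp hω
  by_cases hp : ∃ b, SuspVertex.pole b ∈ ω
  · obtain ⟨b, hb⟩ := hp
    refine Or.inr ⟨b, ⟨basePart ω, h2⟩, Subtype.ext ?_⟩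
    ext x
    rcases x with c | v
    · have : SuspVertex.pole c ∈ ω ↔ c = b := by
        constructor
        · intro hc
          cases b <;> cases c <;> simp_all
        · rintro rfl
          exact hb
      simpa [cone, baseEmb_apply] using this
    · simp [cone, mem_basePart, baseEmb_apply]
  · refine Or.inl ⟨⟨basePart ω, h2⟩, Subtype.ext ?_⟩
    ext x
    rcases x with c | v
    · simpa [base, baseEmb_apply] using fun h => hp ⟨c, h⟩
    · simp [base, mem_basePart, baseEmb_apply]

theorem pos_map (σ : Finset V) (v : V) : pos (σ.map baseEmb) (baseEmb v) = pos σ v := by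
  unfold pos
  rw [Finset.filter_map, Finset.card_map]
  congr 1
  refine Finset.filter_congr fun w _ => ?_
  exact SuspVertex.base_lt_base

theorem pos_insert (b : Bool) (σ : Finset V) (v : V) :
    pos (insert (SuspVertex.pole b) (σ.map baseEmb)) (baseEmb v) = pos σ v + 1 := by
  rw [← pos_map σ, pos, Finset.filter_insert, baseEmb_apply,
    if_pos (SuspVertex.pole_lt_base b v),
    Finset.card_insert_of_notMem (fun h => pole_notMem_map b σ (Finset.mem_filter.mp h).1), pos]

theorem pos_pole (b : Bool) (σ : Finset V) :
    pos (insert (SuspVertex.pole b) (σ.map baseEmb)) (SuspVertex.pole b) = 0 := by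
  unfold pos
  rw [Finset.card_eq_zero, Finset.filter_eq_empty_iff]
  intro x hx
  rw [Finset.mem_insert] at hx
  rcases hx with rfl | hx
  · exact lt_irrefl _
  · obtain ⟨v, -, rfl⟩ := Finset.mem_map.mp hx
    exact (SuspVertex.pole_lt_base b v).asymm

theorem d_base (φ : Cochain k (susp K)) (σ : AugFace K) :
    d k (susp K) φ (base σ) = d k K (fun τ => φ (base τ)) σ := by
  simp only [d, LinearMap.coe_mk, AddHom.coe_mk, base, Finset.sum_map, pos_map]
  refine Finset.sum_congr rfl fun v _ => ?_
  congr 2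
  exact Subtype.ext (Finset.map_erase baseEmb σ.1 v).symm

theorem d_cone (b : Bool) (φ : Cochain k (susp K)) (σ : AugFace K) :
    d k (susp K) φ (cone b σ) = φ (base σ) - d k K (fun τ => φ (cone b τ)) σ := by
  have hp := pole_notMem_map b σ.1
  simp only [d, LinearMap.coe_mk, AddHom.coe_mk, cone]
  rw [Finset.sum_insert hp, pos_pole, pow_zero, one_mul, Finset.sum_map, sub_eq_add_neg,
    ← Finset.sum_neg_distrib]
  congr 1
  · congr 1
    exact Subtype.ext (Finset.erase_insert hp)
  · refine Finset.sum_congr rfl fun v _ => ?_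
    rw [pos_insert, pow_succ, mul_neg_one, neg_mul]
    congr 3
    refine Subtype.ext ?_
    change Finset.erase _ _ = insert _ ((σ.1.erase v).map _)
    rw [Finset.map_erase, Finset.erase_insert_of_ne]
    simp [baseEmb_apply]

theorem card_base (σ : AugFace K) : (base σ).1.card = σ.1.card := Finset.card_map _

theorem card_cone (b : Bool) (σ : AugFace K) : (cone b σ).1.card = σ.1.card + 1 := by
  rw [cone, Finset.card_insert_of_notMem (pole_notMem_map b σ.1), Finset.card_map]

variable (K)

/-- Suspension of cochains: the external product with the cochain on `S⁰` that is `1` on the pole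
`true` and `0` on the pole `false`. -/
def suspCochain : Cochain k K →ₗ[k] Cochain k (susp K) where
  toFun φ ω := if SuspVertex.pole true ∈ ω.1 then
    φ ⟨basePart ω.1, (aug_susp_iff.mp ω.2).2⟩ else 0
  map_add' φ ψ := by
    funext ω
    simp only [Pi.add_apply]
    split_ifs <;> simp
  map_smul' c φ := by
    funext ω
    simp only [Pi.smul_apply, RingHom.id_apply]
    split_ifs <;> simp

/-- Evaluation of cochains on the suspensions of simplices. -/
def desuspCochain : Cochain k (susp K) →ₗ[k] Cochain k K where
  toFun φ σ := φ (cone true σ) - φ (cone false σ)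
  map_add' φ ψ := by
    funext ω
    simp only [Pi.add_apply]
    ring
  map_smul' c φ := by
    funext ω
    simp only [Pi.smul_apply, RingHom.id_apply, smul_eq_mul]
    ring

theorem suspCochain_base (φ : Cochain k K) (σ : AugFace K) :
    suspCochain k K φ (base σ) = 0 :=
  if_neg (pole_notMem_map true σ.1)

theorem suspCochain_cone_true (φ : Cochain k K) (σ : AugFace K) :
    suspCochain k K φ (cone true σ) = φ σ := by
  have h : SuspVertex.pole true ∈ (cone true σ).1 := Finset.mem_insert_self _ _
  refine (if_pos h).trans ?_
  congr 1
  exact Subtype.ext (basePart_insert true σ.1)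

theorem suspCochain_cone_false (φ : Cochain k K) (σ : AugFace K) :
    suspCochain k K φ (cone false σ) = 0 :=
  if_neg (by simp [cone, baseEmb_apply])

theorem d_suspCochain (φ : Cochain k K) :
    d k (susp K) (suspCochain k K φ) = - suspCochain k K (d k K φ) := by
  funext ω
  rcases susp_cases ω with ⟨σ, rfl⟩ | ⟨b, σ, rfl⟩
  · simp only [d_base, suspCochain_base, Pi.neg_apply, neg_zero]
    exact congrFun (map_zero (d k K)) σ
  · rw [d_cone, suspCochain_base, zero_sub, Pi.neg_apply]
    congr 1
    cases b
    · simp only [suspCochain_cone_false]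
      exact congrFun (map_zero (d k K)) σ
    · simp only [suspCochain_cone_true]

theorem d_desuspCochain (φ : Cochain k (susp K)) :
    d k K (desuspCochain k K φ) = - desuspCochain k K (d k (susp K) φ) := by
  funext σ
  have h : desuspCochain k K φ = (fun τ => φ (cone true τ)) - fun τ => φ (cone false τ) := rfl
  rw [h, map_sub, Pi.sub_apply, Pi.neg_apply]
  change _ = - (d k (susp K) φ (cone true σ) - d k (susp K) φ (cone false σ))
  rw [d_cone, d_cone]
  ring

theorem suspCochain_mem (q : ℕ) {φ : Cochain k K} (hφ : φ ∈ homogeneous k K q) :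
    suspCochain k K φ ∈ homogeneous k (susp K) (q + 1) := by
  intro ω hω
  rcases susp_cases ω with ⟨σ, rfl⟩ | ⟨b, σ, rfl⟩
  · exact suspCochain_base k K φ σ
  · cases b
    · exact suspCochain_cone_false k K φ σ
    · rw [suspCochain_cone_true]
      rw [card_cone] at hω
      exact hφ σ (fun h => hω (by rw [h]))

theorem desuspCochain_mem (q : ℕ) {φ : Cochain k (susp K)}
    (hφ : φ ∈ homogeneous k (susp K) (q + 1)) :
    desuspCochain k K φ ∈ homogeneous k K q := by
  intro σ hσ
  have h : ∀ b, φ (cone b σ) = 0 := fun b =>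
    hφ _ (by rw [card_cone]; exact fun h => hσ (Nat.succ_injective h))
  change φ (cone true σ) - φ (cone false σ) = 0
  rw [h, h, sub_zero]

/-- The suspension homomorphism `H̃^{q-1}(K) → H̃^q(ΣK)`. -/
def suspH (q : ℕ) : RedH k K q →ₗ[k] RedH k (susp K) (q + 1) :=
  RedH.map (suspCochain k K)
    (fun φ hφ => ⟨suspCochain_mem k K q hφ.1, by
      refine LinearMap.mem_ker.mpr ?_
      rw [d_suspCochain, LinearMap.mem_ker.mp hφ.2, map_zero, neg_zero]⟩)
    (fun φ hφ => by
      cases q with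
      | zero =>
        rw [show φ = 0 from hφ, map_zero]
        exact Submodule.zero_mem _
      | succ q =>
        obtain ⟨η, hη, rfl⟩ := hφ
        refine ⟨- suspCochain k K η, Submodule.neg_mem _ (suspCochain_mem k K q hη), ?_⟩
        rw [map_neg, d_suspCochain, neg_neg])

/-- The map `H̃^q(ΣK) → H̃^{q-1}(K)` inverse to the suspension homomorphism. -/
def desuspH (q : ℕ) : RedH k (susp K) (q + 1) →ₗ[k] RedH k K q :=
  RedH.map (desuspCochain k K)
    (fun φ hφ => ⟨desuspCochain_mem k K q hφ.1, by
      refine LinearMap.mem_ker.mpr ?_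
      rw [d_desuspCochain, LinearMap.mem_ker.mp hφ.2, map_zero, neg_zero]⟩)
    (fun φ hφ => by
      obtain ⟨η, hη, rfl⟩ := hφ
      cases q with
      | zero =>
        change desuspCochain k K (d k (susp K) η) = 0
        rw [← neg_eq_zero, ← d_desuspCochain]
        have : desuspCochain k K η = 0 := by
          funext σ
          have h : ∀ b, η (cone b σ) = 0 := fun b =>
            hη _ (by rw [card_cone]; exact Nat.succ_ne_zero _)
          change η (cone true σ) - η (cone false σ) = 0
          rw [h, h, sub_zero]
        rw [this, map_zero]
      | succ q =>
        refine ⟨- desuspCochain k K η, Submodule.neg_mem _ (desuspCochain_mem k K q hη), ?_⟩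
        rw [map_neg, d_desuspCochain, neg_neg])

/-- The cochain on `ΣK` which on simplices of `K` is given by the value on the cone over `false`. -/
def homotopyCochain (φ : Cochain k (susp K)) : Cochain k (susp K) := fun ω =>
  if SuspVertex.pole true ∈ ω.1 ∨ SuspVertex.pole false ∈ ω.1 then 0
  else φ (cone false ⟨basePart ω.1, (aug_susp_iff.mp ω.2).2⟩)

theorem homotopyCochain_base (φ : Cochain k (susp K)) (σ : AugFace K) :
    homotopyCochain k K φ (base σ) = φ (cone false σ) := by
  refine (if_neg (by simp [base, baseEmb_apply])).trans ?_
  congr 2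
  exact Subtype.ext (basePart_map σ.1)

theorem homotopyCochain_cone (b : Bool) (φ : Cochain k (susp K)) (σ : AugFace K) :
    homotopyCochain k K φ (cone b σ) = 0 :=
  if_pos (by cases b <;> simp [cone])

/-- The suspension isomorphism `H̃^{q-1}(K) ≅ H̃^q(ΣK)`. -/
def suspEquiv (q : ℕ) : RedH k K q ≃ₗ[k] RedH k (susp K) (q + 1) :=
  LinearEquiv.ofLinearMap (suspH k K q) (desuspH k K q)
    (LinearMap.ext fun a => by
      induction a using Submodule.Quotient.induction_on with
      | H φ =>
        obtain ⟨φ, hφ, hd⟩ := φ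
        refine (Submodule.Quotient.eq _).mpr ?_
        refine ⟨- homotopyCochain k K φ, Submodule.neg_mem _ ?_, ?_⟩
        · intro ω hω
          rcases susp_cases ω with ⟨σ, rfl⟩ | ⟨b, σ, rfl⟩
          · rw [homotopyCochain_base]
            rw [card_base] at hω
            exact hφ _ (by rw [card_cone]; exact fun h => hω (Nat.succ_injective h))
          · exact homotopyCochain_cone k K b φ σ
        · have hz : ∀ ω, d k (susp K) φ ω = 0 := fun ω => congrFun (LinearMap.mem_ker.mp hd) ω
          funext ω
          change d k (susp K) (- homotopyCochain k K φ) ω =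
            suspCochain k K (desuspCochain k K φ) ω - φ ω
          rw [map_neg, Pi.neg_apply]
          rcases susp_cases ω with ⟨σ, rfl⟩ | ⟨b, σ, rfl⟩
          · rw [d_base, suspCochain_base]
            simp only [homotopyCochain_base]
            have := hz (cone false σ)
            rw [d_cone] at this
            linear_combination this
          · rw [d_cone, homotopyCochain_base]
            simp only [homotopyCochain_cone]
            rw [show d k K (fun _ => (0 : k)) σ = 0 from congrFun (map_zero (d k K)) σ]
            cases b
            · rw [suspCochain_cone_false]
              ring
            · rw [suspCochain_cone_true]
              change _ = φ (cone true σ) - φ (cone false σ) - _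
              ring)
    (LinearMap.ext fun a => by
      induction a using Submodule.Quotient.induction_on with
      | H φ =>
        refine congrArg Submodule.Quotient.mk (Subtype.ext ?_)
        funext σ
        change suspCochain k K φ.1 (cone true σ) - suspCochain k K φ.1 (cone false σ) = φ.1 σ
        rw [suspCochain_cone_true, suspCochain_cone_false, sub_zero])

/-- The reduced cohomology `H̃^i(ΣK)` of the suspension of `K`. -/
abbrev SuspH (i : ℕ) : Type _ := RedH k (susp K) (i + 1)

/-- The `*`-product
`H̃^p(ΣK_J) ⊗ H̃^q(ΣK_L) → H̃^{p+q}(ΣK_{J ∪ L})`, obtained from the one on the reduced cohomology of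
`K_J` and `K_L` through the suspension isomorphisms. -/
def suspStar (J L : Finset V) (hJL : Disjoint J L) (p q : ℕ) :
    SuspH k (full K J) p →ₗ[k] SuspH k (full K L) q →ₗ[k] SuspH k (full K (J ∪ L)) (p + q) :=
  ((star k K J L hJL p q).compl₁₂ (suspEquiv k (full K J) p).symm.toLinearMap
    (suspEquiv k (full K L) q).symm.toLinearMap).compr₂
      (suspEquiv k (full K (J ∪ L)) (p + q)).toLinearMap

end Susp

end Cohomology

end VRCube

end

set_option linter.unusedSectionVars false

noncomputable section

namespace VRCube

/-! ### Complexes of sets without antipodal pairs -/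

/-! Two strings of length `r + 1` are at distance more than `r` only if they differ everywhere, that
is, if they are antipodal. Hence `VR (r + 1) r` consists of the nonempty sets without antipodal
pairs (`isCrossPolytopal_VR`): it is the boundary of a cross-polytope, a join of copies of `S⁰`, one
for each antipodal pair. Everything else uses only this description, stated for an arbitrary
involution `α`.

If some `a ∈ J` has its antipode outside `J`, then `a` can be added to every simplex of `K_J`, so
`K_J` is a cone and its suspension is contractible. Otherwise `J` is a union of `j` pairs. The
differences of opposite barycentric coordinates identify `K_J` with the `ℓ¹` unit sphere of `ℝ^j`,
and suspension adds one coordinate (`nonempty_suspension_homeomorph_taxicabSphere`). Part (1) thus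
holds even up to homeomorphism, including `j = 0`, where `K_J` is empty.

For (3), the fundamental cycle of `K_J` is the join of the 0-cycles `[v] - [α v]`. Evaluation on it
(`fundEval`) kills coboundaries. It is an isomorphism from top cohomology to `k`
(`topEval_bijective`): adjacent facets have dual cochains that agree up to sign and a coboundary, so
one facet generates, and that facet has coefficient `±1` in the cycle. The cycle of a join is the
join of the cycles, so evaluation is multiplicative for the external product (`fundEval_crossFun`,
`topEval_star`). The isomorphisms required are therefore the evaluations, composed with
desuspension. -/

/-- The simplices of `K` are the nonempty finite sets that contain no pair `{a, α a}` for a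
fixed-point free involution `α`; a finite such `K` is the boundary of a cross-polytope. -/
structure IsCrossPolytopal {V : Type*} (K : PreAbstractSimplicialComplex V) (α : V → V) :
    Prop where
  involutive : Function.Involutive α
  apply_ne : ∀ a, α a ≠ a
  mem_faces : ∀ σ, σ ∈ K.faces ↔ σ.Nonempty ∧ ∀ a ∈ σ, α a ∉ σ

theorem antipode_involutive {n : ℕ} : Function.Involutive (antipode (n := n)) := fun a => by
  funext i
  simp [antipode]

theorem hammingDist_eq_iff_eq_not {n : ℕ} (a b : Fin n → Bool) :
    hammingDist a b = n ↔ b = fun i => !(a i) := by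
  have h : hammingDist a b = Fintype.card (Fin n) ↔ ∀ i, a i ≠ b i := by
    simp [hammingDist, Finset.card_eq_iff_eq_univ, Finset.filter_eq_self,
      -Fintype.card_fin]
  rw [Fintype.card_fin] at h
  rw [h, funext_iff]
  exact forall_congr' fun i => by cases a i <;> cases b i <;> simp

/-- Distances never exceed `r + 1`, so the only excluded value is `r + 1`, attained exactly when all
coordinates differ. -/
theorem hamming_le_iff {r : ℕ} (a b : Q (r + 1)) : hamming a b ≤ r ↔ b ≠ antipode a := by
  have h1 : hamming a b ≤ r + 1 := by
    refine (hammingDist_le_card_fintype (β := fun _ : Fin (r + 1) => Bool)).trans ?_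
    simp
  have h2 : hamming a b = r + 1 ↔ b = antipode a := hammingDist_eq_iff_eq_not a b
  rw [Ne, ← h2]
  omega

theorem isCrossPolytopal_VR (r : ℕ) : IsCrossPolytopal (VR (r + 1) r) antipode where
  involutive := antipode_involutive
  -- Coordinate `0` exists because strings have length `r + 1 > 0`.
  apply_ne a h := by simpa [antipode] using congrFun h 0
  mem_faces σ := by
    refine and_congr_right fun _ => ⟨fun h a ha ha' => ?_, fun h a ha b hb => ?_⟩
    · exact (hamming_le_iff a _).mp (h a ha _ ha') rfl
    · exact (hamming_le_iff a b).mpr fun e => h a ha (e ▸ hb)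

/-- The linear order selects the smaller member of each antipodal pair in `J`; an enumeration of
these is the required family. The contrapositive provides the cone apex in part (2). -/
theorem isAntipodalUnion_of_antipode_mem {n : ℕ} (hne : ∀ a : Q n, antipode a ≠ a)
    {J : Finset (Q n)} (h : ∀ a ∈ J, antipode a ∈ J) : ∃ j, IsAntipodalUnion J j := by
  set P := J.filter (fun a => a < antipode a) with hP
  have hv : ∀ i, (P.equivFin.symm i).1 ∈ J ∧
      (P.equivFin.symm i).1 < antipode (P.equivFin.symm i).1 := fun i =>
    Finset.mem_filter.mp (P.equivFin.symm i).2
  refine ⟨P.card, fun i => (P.equivFin.symm i).1, ?_, fun x => ⟨fun hx => ?_, ?_⟩⟩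
  · have hinj : Function.Injective (fun i => (P.equivFin.symm i).1) :=
      Subtype.val_injective.comp P.equivFin.symm.injective
    -- If `v i = antipode (v i')`, then `v i'` is both smaller and larger than its antipode.
    refine hinj.sumElim (antipode_involutive.injective.comp hinj) fun i i' e => ?_
    have h1 := (hv i).2
    have h2 := (hv i').2
    simp only at e
    rw [e, antipode_involutive] at h1
    exact h1.asymm h2
  · rcases lt_or_gt_of_ne (hne x) with hlt | hlt
    · refine ⟨P.equivFin ⟨antipode x, Finset.mem_filter.mpr ⟨h x hx, ?_⟩⟩, Or.inr ?_⟩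
      · rwa [antipode_involutive x]
      · simp [antipode_involutive x]
    · exact ⟨P.equivFin ⟨x, Finset.mem_filter.mpr ⟨hx, hlt⟩⟩, Or.inl (by simp)⟩
  · rintro ⟨i, rfl | rfl⟩
    · exact (hv i).1
    · exact h _ (hv i).1

/-! ### Suspensions -/

namespace Suspension

variable {X Y : Type*}

/-- The point of the suspension of `X` at height `t` over `x`. -/
def mk (x : X) (t : unitInterval) : Suspension X := Quot.mk _ (Sum.inl (x, t))

/-- The poles of the suspension. -/
def pole (X : Type*) (b : Bool) : Suspension X := Quot.mk _ (Sum.inr b)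

theorem mk_zero (x : X) : mk x 0 = pole X false := Quot.sound (SuspensionRel.south x)

theorem mk_one (x : X) : mk x 1 = pole X true := Quot.sound (SuspensionRel.north x)

theorem ind {P : Suspension X → Prop} (hmk : ∀ x t, P (mk x t)) (hpole : ∀ b, P (pole X b))
    (z : Suspension X) : P z := by
  induction z using Quot.ind with
  | mk z =>
    rcases z with ⟨x, t⟩ | b
    · exact hmk x t
    · exact hpole b

/-- Maps out of the suspension. -/
def lift (f : X → unitInterval → Y) (g : Bool → Y) (h0 : ∀ x, f x 0 = g false)
    (h1 : ∀ x, f x 1 = g true) : Suspension X → Y :=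
  Quot.lift (Sum.elim (fun p => f p.1 p.2) g) (by
    rintro _ _ (x | x)
    · exact h0 x
    · exact h1 x)

variable [TopologicalSpace X] [TopologicalSpace Y]

theorem continuous_lift {f : X → unitInterval → Y} {g : Bool → Y} {h0 : ∀ x, f x 0 = g false}
    {h1 : ∀ x, f x 1 = g true} (hf : Continuous fun p : X × unitInterval => f p.1 p.2) :
    Continuous (lift f g h0 h1) :=
  continuous_quot_lift _ (hf.sumElim continuous_of_discreteTopology)

theorem continuous_mk : Continuous fun p : X × unitInterval => mk p.1 p.2 :=
  continuous_quot_mk.comp continuous_inl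

instance [CompactSpace X] : CompactSpace (Suspension X) :=
  inferInstanceAs (CompactSpace (Quot (SuspensionRel X)))

/-- A family of maps out of the suspension parametrized by an interval is jointly continuous if
it is so on the cylinder and on the poles. -/
theorem continuous_uncurry_lift {f : unitInterval → X → unitInterval → Y}
    {g : unitInterval → Bool → Y} {h0 : ∀ s x, f s x 0 = g s false}
    {h1 : ∀ s x, f s x 1 = g s true}
    (hf : Continuous fun p : (X × unitInterval) × unitInterval => f p.2 p.1.1 p.1.2)
    (hg : ∀ b, Continuous fun s => g s b) :
    Continuous fun p : unitInterval × Suspension X => lift (f p.1) (g p.1) (h0 p.1) (h1 p.1) p.2 := by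
  -- The time variable is curried into the target `C(unitInterval, Y)`, so that the map descends
  -- along the quotient defining the suspension, and is uncurried afterwards.
  let F : Suspension X → C(unitInterval, Y) :=
    lift (fun x t => ⟨fun s => f s x t, hf.comp (by fun_prop : Continuous fun s => ((x, t), s))⟩)
      (fun b => ⟨fun s => g s b, hg b⟩) (fun x => ContinuousMap.ext fun s => h0 s x)
      (fun x => ContinuousMap.ext fun s => h1 s x)
  have hF : Continuous F := continuous_lift (ContinuousMap.curry ⟨_, hf⟩).continuous
  have hF' := ContinuousMap.continuous_uncurry_of_continuous ⟨F, hF⟩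
  convert hF'.comp continuous_swap using 1
  funext ⟨s, z⟩
  induction z using ind <;> rfl

/-- Suspending a contraction of `X` to `a` deforms the identity to the collapse `q` onto the
meridian over `a`. The meridian then shrinks to the pole `false`. -/
theorem contractibleSpace [ContractibleSpace X] : ContractibleSpace (Suspension X) := by
  obtain ⟨a, ⟨H⟩⟩ := id_nullhomotopic X
  rw [contractible_iff_id_nullhomotopic]
  let q : C(Suspension X, Suspension X) := ⟨lift (fun _ t => mk a t) (pole X)
    (fun _ => mk_zero a) (fun _ => mk_one a), continuous_lift (continuous_mk.comp (by fun_prop :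
      Continuous fun p : X × unitInterval => (a, p.2)))⟩
  have H1 : (ContinuousMap.id (Suspension X)).Homotopic q := ⟨{
    toFun := fun p => lift (fun x t => mk (H (p.1, x)) t) (pole X) (fun x => mk_zero _)
      (fun x => mk_one _) p.2
    continuous_toFun := continuous_uncurry_lift
      (f := fun s x t => mk (H (s, x)) t) (g := fun _ => pole X)
      (h0 := fun _ _ => mk_zero _) (h1 := fun _ _ => mk_one _)
      (continuous_mk.comp (by fun_prop : Continuous fun p : (X × unitInterval) × unitInterval =>
        (H (p.2, p.1.1), p.1.2))) (fun _ => continuous_const)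
    map_zero_left := fun z => by
      induction z using ind with
      | hmk x t => exact congrArg (fun y => mk y t) (H.apply_zero x)
      | hpole b => rfl
    map_one_left := fun z => by
      induction z using ind with
      | hmk x t => exact congrArg (fun y => mk y t) (H.apply_one x)
      | hpole b => rfl }⟩
  -- Heights are multiplied by the time, from the constant map at time `0` to `q` at time `1`. The
  -- pole `b` has height `0` or `1`, and the pole `true` moves along the meridian.
  have H2 : (ContinuousMap.const (Suspension X) (pole X false)).Homotopic q := ⟨{
    toFun := fun p => lift (fun _ t => mk a (p.1 * t)) (fun b => mk a (p.1 * bif b then 1 else 0))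
      (fun x => rfl) (fun x => rfl) p.2
    continuous_toFun := continuous_uncurry_lift
      (f := fun s x t => mk a (s * t)) (g := fun s b => mk a (s * bif b then 1 else 0))
      (h0 := fun _ _ => rfl) (h1 := fun _ _ => rfl)
      (continuous_mk.comp (by fun_prop : Continuous fun p : (X × unitInterval) × unitInterval =>
        (a, p.2 * p.1.2)))
      (fun b => continuous_mk.comp (by fun_prop :
        Continuous fun s : unitInterval => (a, s * bif b then 1 else 0)))
    map_zero_left := fun z => by
      induction z using ind with
      | hmk x t =>
        change mk a (0 * t) = _
        rw [zero_mul]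
        exact mk_zero a
      | hpole b =>
        change mk a (0 * _) = _
        rw [zero_mul]
        exact mk_zero a
    map_one_left := fun z => by
      induction z using ind with
      | hmk x t =>
        change mk a (1 * t) = mk a t
        rw [one_mul]
      | hpole b =>
        change mk a (1 * _) = _
        rw [one_mul]
        cases b
        · exact mk_zero a
        · exact mk_one a }⟩
  exact ⟨pole X false, H1.trans H2.symm⟩

end Suspension

/-! ### Realizations -/

section Realization

variable {V : Type*} [Fintype V] {K : PreAbstractSimplicialComplex V}

/-- The realization is cut out of the compact standard simplex by a finite union of coordinate
subspaces. Compactness later turns a continuous bijection into a homeomorphism. -/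
instance : CompactSpace (Realization K) := by
  refine isCompact_iff_compactSpace.mp ?_
  have h : {x : V → ℝ | x ∈ stdSimplex ℝ V ∧ ∃ σ ∈ K.faces, ∀ v, x v ≠ 0 → v ∈ σ} =
      stdSimplex ℝ V ∩ ⋃ σ ∈ K.faces, ⋂ v ∈ {v | v ∉ σ}, {x : V → ℝ | x v = 0} := by
    ext x
    simp only [Set.mem_ofPred_eq, Set.mem_inter_iff, Set.mem_iUnion, Set.mem_iInter, exists_prop]
    refine and_congr_right fun _ => exists_congr fun σ => and_congr_right fun _ =>
      forall_congr' fun v => by tauto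
  change IsCompact {x : V → ℝ | x ∈ stdSimplex ℝ V ∧ ∃ σ ∈ K.faces, ∀ v, x v ≠ 0 → v ∈ σ}
  rw [h]
  refine (isCompact_stdSimplex ℝ V).inter_right ((Set.toFinite _).isClosed_biUnion fun σ _ =>
    isClosed_biInter fun v _ => isClosed_eq (continuous_apply v) continuous_const)

/-- A simplicial cone is contractible, by moving along straight lines towards the apex. -/
theorem contractibleSpace_realization_of_cone [DecidableEq V] {a : V} (ha : {a} ∈ K.faces)
    (h : ∀ σ ∈ K.faces, insert a σ ∈ K.faces) : ContractibleSpace (Realization K) := by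
  have hs : Pi.single a 1 ∈ stdSimplex ℝ V := single_mem_stdSimplex ℝ a
  let c : Realization K := ⟨Pi.single a 1, hs, {a}, ha, fun v hv => by
    by_contra hne
    exact hv (Pi.single_eq_of_ne (by simpa using hne) _)⟩
  rw [contractible_iff_id_nullhomotopic]
  refine ⟨c, ⟨{
    toFun := fun p => ⟨(1 - (p.1 : ℝ)) • p.2.1 + (p.1 : ℝ) • Pi.single a 1, ?_, ?_⟩
    continuous_toFun := ?_
    map_zero_left := fun x => Subtype.ext (by simp)
    map_one_left := fun x => Subtype.ext (by simp [c]; rfl) }⟩⟩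
  · exact convex_stdSimplex ℝ V p.2.2.1 hs (sub_nonneg.mpr p.1.2.2) p.1.2.1 (by ring)
  · obtain ⟨σ, hσ, hv⟩ := p.2.2.2
    refine ⟨insert a σ, h σ hσ, fun v hne => ?_⟩
    by_contra hn
    rw [Finset.mem_insert, not_or] at hn
    refine hne ?_
    have h0 : p.2.1 v = 0 := by_contra fun h' => hn.2 (hv v h')
    simp [h0, Pi.single_eq_of_ne hn.1]
  · refine Continuous.subtype_mk ?_ _
    have : Continuous fun p : unitInterval × Realization K => p.2.1 :=
      continuous_subtype_val.comp continuous_snd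
    fun_prop

end Realization

/-! ### Spheres for the `ℓ¹` norm -/

/-- The unit sphere of `ℝⁿ` for the `ℓ¹` norm. -/
abbrev TaxicabSphere (n : ℕ) : Type := {w : Fin n → ℝ // ∑ i, |w i| = 1}

/-- Radial projection from the `ℓ¹` sphere to the Euclidean one. -/
def taxicabSphereHomeomorph (n : ℕ) :
    TaxicabSphere n ≃ₜ Metric.sphere (0 : EuclideanSpace ℝ (Fin n)) 1 := by
  have hne : ∀ w : TaxicabSphere n, WithLp.toLp 2 w.1 ≠ 0 := fun w h => by
    have h0 : w.1 = 0 := congrArg WithLp.ofLp h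
    simpa [h0] using w.2
  have hpos : ∀ w : TaxicabSphere n, 0 < ‖WithLp.toLp 2 w.1‖ := fun w => norm_pos_iff.mpr (hne w)
  have hsum : ∀ z : Metric.sphere (0 : EuclideanSpace ℝ (Fin n)) 1, 0 < ∑ i, |z.1 i| := fun z => by
    refine lt_of_le_of_ne (Finset.sum_nonneg fun i _ => abs_nonneg _) fun h => ?_
    have h0 : z.1 = 0 := by
      ext i
      simpa using (Finset.sum_eq_zero_iff_of_nonneg fun i _ => abs_nonneg _).mp h.symm i
        (Finset.mem_univ i)
    simpa [h0] using z.2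
  have hz : ∀ z : Metric.sphere (0 : EuclideanSpace ℝ (Fin n)) 1, ‖z.1‖ = 1 := fun z => by
    simp
  exact
  { toFun := fun w => ⟨‖WithLp.toLp 2 w.1‖⁻¹ • WithLp.toLp 2 w.1, by
      rw [mem_sphere_zero_iff_norm, norm_smul, norm_inv, norm_norm,
        inv_mul_cancel₀ (hpos w).ne']⟩
    invFun := fun z => ⟨fun i => (∑ i, |z.1 i|)⁻¹ * z.1 i, by
      simp_rw [abs_mul]
      rw [← Finset.mul_sum, abs_of_pos (inv_pos.mpr (hsum z)), inv_mul_cancel₀ (hsum z).ne']⟩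
    left_inv := fun w => Subtype.ext <| funext fun i => by
      have := (hpos w).ne'
      simp only [PiLp.smul_apply, smul_eq_mul, abs_mul, ← Finset.mul_sum, w.2]
      rw [abs_of_pos (inv_pos.mpr (hpos w))]
      field_simp
    right_inv := fun z => Subtype.ext <| by
      have hv : WithLp.toLp 2 (fun i => (∑ i, |z.1 i|)⁻¹ * z.1 i) = (∑ i, |z.1 i|)⁻¹ • z.1 := by
        ext i
        simp
      simp only [hv, norm_smul, hz z, smul_smul, norm_inv, Real.norm_eq_abs]
      rw [abs_of_pos (hsum z), mul_one, inv_inv, mul_inv_cancel₀ (hsum z).ne', one_smul]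
    continuous_toFun := by
      refine Continuous.subtype_mk ?_ _
      have hc : Continuous fun w : TaxicabSphere n =>
          (WithLp.toLp 2 w.1 : EuclideanSpace ℝ (Fin n)) := by
        fun_prop
      exact (hc.norm.inv₀ fun w => (hpos w).ne').smul hc
    continuous_invFun := by
      refine Continuous.subtype_mk (continuous_pi fun i => ?_) _
      refine Continuous.mul (Continuous.inv₀ (by fun_prop) fun z => (hsum z).ne') (by fun_prop) }

/-- If a compact space maps continuously and bijectively to the `ℓ¹` sphere of `ℝⁿ`, then its
suspension is homeomorphic to the `ℓ¹` sphere of `ℝⁿ⁺¹`. -/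
theorem nonempty_suspension_homeomorph_taxicabSphere {n : ℕ} {X : Type*} [TopologicalSpace X]
    [CompactSpace X] {y : X → TaxicabSphere n} (hy : Continuous y) (hbij : Function.Bijective y) :
    Nonempty (Suspension X ≃ₜ TaxicabSphere (n + 1)) := by
  have habs : ∀ t : unitInterval, |2 * (t : ℝ) - 1| ≤ 1 := fun t => by
    have h1 := t.2.1
    have h2 := t.2.2
    rw [abs_le]
    constructor <;> linarith
  -- The height `t` becomes the first coordinate `2 t - 1 ∈ [-1, 1]`; the remaining `ℓ¹` mass `1 -
  -- |2 t - 1|` scales the point `y x`.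
  let F : X → unitInterval → TaxicabSphere (n + 1) := fun x t =>
    ⟨Fin.cons (2 * (t : ℝ) - 1) fun i => (1 - |2 * (t : ℝ) - 1|) * (y x).1 i, by
      rw [Fin.sum_univ_succ]
      simp only [Fin.cons_zero, Fin.cons_succ, abs_mul, ← Finset.mul_sum, (y x).2]
      rw [abs_of_nonneg (sub_nonneg.mpr (habs t))]
      ring⟩
  let G : Bool → TaxicabSphere (n + 1) := fun b =>
    ⟨Fin.cons (bif b then 1 else -1) 0, by
      rw [Fin.sum_univ_succ]
      cases b <;> simp⟩
  have h0 : ∀ x, F x 0 = G false := fun x => Subtype.ext <| by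
    refine funext (Fin.cases ?_ fun i => ?_) <;> simp [F, G]
  have h1 : ∀ x, F x 1 = G true := fun x => Subtype.ext <| by
    refine funext (Fin.cases ?_ fun i => ?_) <;> norm_num [F, G]
  have hF : Continuous fun p : X × unitInterval => F p.1 p.2 := by
    refine Continuous.subtype_mk (continuous_pi (Fin.cases ?_ fun i => ?_)) _
    · simp only [Fin.cons_zero]
      fun_prop
    · simp only [Fin.cons_succ]
      have : Continuous fun x => (y x).1 i :=
        (continuous_apply i).comp (continuous_subtype_val.comp hy)
      fun_prop
  have hFt : ∀ {x t x' t'}, F x t = F x' t' → t = t' := fun {x t x' t'} h => by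
    have := congrFun (congrArg Subtype.val h) 0
    simp only [F, Fin.cons_zero] at this
    exact Subtype.ext (by linarith)
  have hFG : ∀ {x t b}, F x t = G b → Suspension.mk x t = Suspension.pole X b := fun {x t b} h => by
    cases b
    · rw [← h0 x] at h
      rw [hFt h, Suspension.mk_zero]
    · rw [← h1 x] at h
      rw [hFt h, Suspension.mk_one]
  have hinj : Function.Injective (Suspension.lift F G h0 h1) := by
    intro z z' h
    induction z using Suspension.ind with
    | hmk x t =>
      induction z' using Suspension.ind with
      | hmk x' t' =>
        change F x t = F x' t' at h
        obtain rfl := hFt h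
        by_cases ht0 : t = 0
        · rw [ht0, Suspension.mk_zero, Suspension.mk_zero]
        by_cases ht1 : t = 1
        · rw [ht1, Suspension.mk_one, Suspension.mk_one]
        -- Away from the poles the scaling factor is positive, so it cancels and injectivity of `y`
        -- applies.
        have hlt : |2 * (t : ℝ) - 1| < 1 := by
          have h1 := lt_of_le_of_ne t.2.1 fun h => ht0 (Subtype.ext h.symm)
          have h2 := lt_of_le_of_ne t.2.2 fun h => ht1 (Subtype.ext h)
          rw [abs_lt]
          constructor <;> linarith
        rw [show x = x' from hbij.1 (Subtype.ext (funext fun i => ?_))]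
        have := congrFun (congrArg Subtype.val h) i.succ
        simp only [F, Fin.cons_succ] at this
        exact mul_left_cancel₀ (sub_pos.mpr hlt).ne' this
      | hpole b => exact hFG h
    | hpole b =>
      induction z' using Suspension.ind with
      | hmk x t => exact (hFG h.symm).symm
      | hpole b' =>
        have := congrFun (congrArg Subtype.val (show G b = G b' from h)) 0
        simp only [G, Fin.cons_zero] at this
        cases b <;> cases b' <;> first | rfl | norm_num at this
  have hsurj : Function.Surjective (Suspension.lift F G h0 h1) := by
    intro w
    have hw := w.2
    rw [Fin.sum_univ_succ] at hw
    have hnn : 0 ≤ ∑ i : Fin n, |w.1 i.succ| := Finset.sum_nonneg fun i _ => abs_nonneg _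
    -- A point with vanishing tail is the image of a pole, which exists even when `X` is empty.
    -- Otherwise the normalized tail lies on the smaller sphere and comes from `X`.
    rcases hnn.eq_or_lt with hz | hp
    · have hi : ∀ i : Fin n, w.1 i.succ = 0 := fun i => by
        simpa using (Finset.sum_eq_zero_iff_of_nonneg fun i _ => abs_nonneg _).mp hz.symm i
          (Finset.mem_univ i)
      rw [← hz, add_zero] at hw
      rcases eq_or_eq_neg_of_abs_eq hw with h | h
      · refine ⟨Suspension.pole X true, Subtype.ext (funext (Fin.cases ?_ fun i => ?_))⟩
        · exact h.symm
        · exact (hi i).symm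
      · refine ⟨Suspension.pole X false, Subtype.ext (funext (Fin.cases ?_ fun i => ?_))⟩
        · exact h.symm
        · exact (hi i).symm
    · set c := ∑ i : Fin n, |w.1 i.succ| with hc
      obtain ⟨x, hx⟩ := hbij.2 ⟨fun i => c⁻¹ * w.1 i.succ, by
        simp_rw [abs_mul]
        rw [← Finset.mul_sum, abs_of_pos (inv_pos.mpr hp), inv_mul_cancel₀ hp.ne']⟩
      have hle : |w.1 0| ≤ 1 := by linarith
      rw [abs_le] at hle
      have ht : 2 * ((w.1 0 + 1) / 2) - 1 = w.1 0 := by ring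
      refine ⟨Suspension.mk x ⟨(w.1 0 + 1) / 2, by constructor <;> linarith⟩,
        Subtype.ext (funext (Fin.cases ?_ fun i => ?_))⟩
      · exact ht
      · change (1 - |2 * ((w.1 0 + 1) / 2) - 1|) * (y x).1 i = _
        rw [ht, hx, show 1 - |w.1 0| = c by linarith]
        change c * (c⁻¹ * _) = _
        rw [mul_inv_cancel_left₀ hp.ne']
  exact ⟨Continuous.homeoOfEquivCompactToT2
    (f := Equiv.ofBijective _ ⟨hinj, hsurj⟩) (Suspension.continuous_lift (h0 := h0) (h1 := h1) hF)⟩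

/-! ### Realizations of cross-polytopes -/

section CrossPolytope

variable {V : Type*} [Fintype V] {K : PreAbstractSimplicialComplex V} {α : V → V} {J : Finset V}

/-- The support of `x` is the smallest possible carrier, and it is nonempty because the coordinates
sum to `1`; so the condition can be tested on the support. -/
theorem IsCrossPolytopal.realization_iff [DecidableEq V] (hK : IsCrossPolytopal K α) {x : V → ℝ}
    (hx : x ∈ stdSimplex ℝ V) : (∃ σ ∈ (full K J).faces, ∀ v, x v ≠ 0 → v ∈ σ) ↔
      ∀ v, x v ≠ 0 → v ∈ J ∧ x (α v) = 0 := by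
  constructor
  · rintro ⟨σ, ⟨hσ, hJ⟩, h⟩ v hv
    refine ⟨hJ (h v hv), by_contra fun hv' => ?_⟩
    exact ((hK.mem_faces σ).mp hσ).2 v (h v hv) (h _ hv')
  · intro h
    refine ⟨Finset.univ.filter (x · ≠ 0), ⟨(hK.mem_faces _).mpr ⟨?_, fun v hv => ?_⟩,
      fun v hv => ?_⟩, fun v hv => by simpa using hv⟩
    · rw [Finset.nonempty_iff_ne_empty]
      intro h0
      have hs := hx.2
      rw [Finset.sum_eq_zero fun v _ => by_contra fun hv =>
        Finset.notMem_empty v (h0 ▸ Finset.mem_filter.mpr ⟨Finset.mem_univ v, hv⟩)] at hs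
      exact zero_ne_one hs
    · simpa using (h v (by simpa using hv)).2
    · exact (h v (by simpa using hv)).1

/-- At each point one of the two coordinates at `v i` and `α (v i)` vanishes. Their difference
therefore determines both, as its positive and negative parts, and its absolute value is their sum.
-/
theorem IsCrossPolytopal.suspension_homeomorph_sphere (hK : IsCrossPolytopal K α) {j : ℕ}
    {v : Fin j → V} (hv : Function.Injective (Sum.elim v fun i => α (v i)))
    (hJ : ∀ x, x ∈ J ↔ ∃ i, x = v i ∨ x = α (v i)) :
    Nonempty (Suspension (Realization (full K J)) ≃ₜ Sphere j) := by
  classical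
  have hprop : ∀ (x : Realization (full K J)) w, x.1 w ≠ 0 → w ∈ J ∧ x.1 (α w) = 0 := fun x =>
    (hK.realization_iff x.2.1).mp x.2.2
  have hor : ∀ (x : Realization (full K J)) i, x.1 (v i) = 0 ∨ x.1 (α (v i)) = 0 := fun x i =>
    or_iff_not_imp_left.mpr fun h => (hprop x _ h).2
  have hnn : ∀ (x : Realization (full K J)) w, 0 ≤ x.1 w := fun x w => x.2.1.1 w
  let y : Realization (full K J) → TaxicabSphere j := fun x =>
    ⟨fun i => x.1 (v i) - x.1 (α (v i)), by
      rw [← x.2.1.2, ← Fintype.sum_of_injective _ hv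
        (Sum.elim (fun i => x.1 (v i)) fun i => x.1 (α (v i))) x.1, Fintype.sum_sum_type,
        ← Finset.sum_add_distrib]
      · refine Finset.sum_congr rfl fun i _ => ?_
        rcases hor x i with h | h <;> simp [h, hnn]
      · intro w hw
        by_contra h
        obtain ⟨i, rfl | rfl⟩ := (hJ w).mp (hprop x w h).1
        · exact hw ⟨Sum.inl i, rfl⟩
        · exact hw ⟨Sum.inr i, rfl⟩
      · rintro (i | i) <;> rfl⟩
  have hy : Continuous y := by
    refine Continuous.subtype_mk (continuous_pi fun i => ?_) _
    have : ∀ w, Continuous fun x : Realization (full K J) => x.1 w := fun w =>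
      (continuous_apply w).comp continuous_subtype_val
    exact (this _).sub (this _)
  have hbij : Function.Bijective y := by
    constructor
    · intro x x' h
      -- When the vanishing coordinates of `x` and `x'` are opposite, a nonnegative number equals a
      -- nonpositive one, so both are zero.
      have hi : ∀ i, x.1 (v i) = x'.1 (v i) ∧ x.1 (α (v i)) = x'.1 (α (v i)) := fun i => by
        have e := congrFun (congrArg Subtype.val h) i
        simp only [y] at e
        have := hnn x (v i)
        have := hnn x (α (v i))
        have := hnn x' (v i)
        have := hnn x' (α (v i))
        rcases hor x i with h | h <;> rcases hor x' i with h' | h' <;> rw [h, h'] at e ⊢ <;>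
          constructor <;> linarith
      refine Subtype.ext (funext fun w => ?_)
      by_cases hw : w ∈ J
      · obtain ⟨i, rfl | rfl⟩ := (hJ w).mp hw
        · exact (hi i).1
        · exact (hi i).2
      · have h0 : ∀ z : Realization (full K J), z.1 w = 0 := fun z =>
          by_contra fun h => hw (hprop z w h).1
        rw [h0, h0]
    · intro u
      -- The preimage of `u` has the positive and negative parts of `u i` at `v i` and `α (v i)`,
      -- and is zero off `J`.
      let g : Fin j ⊕ Fin j → ℝ := Sum.elim (fun i => max (u.1 i) 0) fun i => max (-u.1 i) 0
      let x : V → ℝ := Function.extend (Sum.elim v fun i => α (v i)) g 0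
      have hx1 : ∀ i, x (v i) = max (u.1 i) 0 := fun i => hv.extend_apply g (0 : V → ℝ) (Sum.inl i)
      have hx2 : ∀ i, x (α (v i)) = max (-u.1 i) 0 := fun i => hv.extend_apply g (0 : V → ℝ) (Sum.inr i)
      have hx0 : ∀ w, (¬ ∃ a, Sum.elim v (fun i => α (v i)) a = w) → x w = 0 := fun w hw =>
        Function.extend_apply' g (0 : V → ℝ) w hw
      have hxJ : ∀ w, x w ≠ 0 → w ∈ J := fun w hw => by
        by_contra hwJ
        refine hw (hx0 w ?_)
        rintro ⟨i | i, rfl⟩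
        · exact hwJ ((hJ _).mpr ⟨i, Or.inl rfl⟩)
        · exact hwJ ((hJ _).mpr ⟨i, Or.inr rfl⟩)
      have hs : x ∈ stdSimplex ℝ V := by
        constructor
        · intro w
          by_cases hw : ∃ a, Sum.elim v (fun i => α (v i)) a = w
          · obtain ⟨i | i, rfl⟩ := hw
            · exact (hx1 i).symm ▸ le_max_right _ _
            · exact (hx2 i).symm ▸ le_max_right _ _
          · exact (hx0 w hw).ge
        · rw [← Fintype.sum_of_injective _ hv g x hx0 fun a => (hv.extend_apply g (0 : V → ℝ) a).symm,
            Fintype.sum_sum_type, ← Finset.sum_add_distrib, ← u.2]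
          refine Finset.sum_congr rfl fun i _ => ?_
          rcases le_total 0 (u.1 i) with h | h <;> simp [g, h, abs_of_nonneg, abs_of_nonpos]
      refine ⟨⟨x, hs, (hK.realization_iff hs).mpr fun w hw => ⟨hxJ w hw, ?_⟩⟩,
        Subtype.ext (funext fun i => ?_)⟩
      · obtain ⟨i, rfl | rfl⟩ := (hJ w).mp (hxJ w hw)
        · rw [hx1] at hw
          rw [hx2]
          rcases le_total 0 (u.1 i) with h | h <;> simp_all
        · rw [hx2] at hw
          rw [hK.involutive, hx1]
          rcases le_total 0 (u.1 i) with h | h <;> simp_all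
      · change x (v i) - x (α (v i)) = u.1 i
        rw [hx1, hx2]
        rcases le_total 0 (u.1 i) with h | h <;> simp [h]
  obtain ⟨e⟩ := nonempty_suspension_homeomorph_taxicabSphere hy hbij
  exact ⟨e.trans (taxicabSphereHomeomorph (j + 1))⟩

/-- The only vertex that cannot share a simplex with `a` is `α a`, which is missing from `J`; so
`K_J` is a cone with apex `a`. -/
theorem IsCrossPolytopal.contractibleSpace_realization (hK : IsCrossPolytopal K α) {a : V}
    (ha : a ∈ J) (ha' : α a ∉ J) : ContractibleSpace (Realization (full K J)) := by
  classical
  refine contractibleSpace_realization_of_cone (a := a) ⟨(hK.mem_faces _).mpr ⟨by simp, ?_⟩,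
    by simpa using ha⟩ ?_
  · simpa using hK.apply_ne a
  · rintro σ ⟨hσ, hσJ⟩
    have hσ' := ((hK.mem_faces σ).mp hσ).2
    refine ⟨(hK.mem_faces _).mpr ⟨by simp, fun b hb => ?_⟩, Finset.insert_subset ha hσJ⟩
    rw [Finset.mem_insert, not_or]
    rw [Finset.mem_insert] at hb
    rcases hb with rfl | hb
    · exact ⟨hK.apply_ne _, fun h => ha' (hσJ h)⟩
    · refine ⟨fun h => ha' ?_, hσ' b hb⟩
      rw [← h, hK.involutive]
      exact hσJ hb

end CrossPolytope

/-! ### Top cohomology of cross-polytopes -/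

section Transversal

variable {V : Type*} [LinearOrder V] {α : V → V}

/-- The list `l` picks one vertex out of each pair `{a, α a}` contained in `J`. -/
structure IsSection (α : V → V) (J : Finset V) (l : List V) : Prop where
  pairwise : l.Pairwise fun a b => b ≠ a ∧ b ≠ α a
  mem_iff : ∀ x, x ∈ J ↔ x ∈ l ∨ α x ∈ l

/-- The sets that contain exactly one of `a` and `α a` for each entry `a` of a list. -/
inductive IsTransversal (α : V → V) : List V → Finset V → Prop
  | nil : IsTransversal α [] ∅
  | left {v l σ} (h : IsTransversal α l σ) : IsTransversal α (v :: l) (insert v σ)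
  | right {v l σ} (h : IsTransversal α l σ) : IsTransversal α (v :: l) (insert (α v) σ)

theorem IsTransversal.mem_or {l : List V} {σ : Finset V} (h : IsTransversal α l σ) {x : V}
    (hx : x ∈ l) : x ∈ σ ∨ α x ∈ σ := by
  induction h <;> grind

theorem IsTransversal.mem_of_mem (hα : Function.Involutive α) {l : List V} {σ : Finset V}
    (h : IsTransversal α l σ) {x : V} (hx : x ∈ σ) : x ∈ l ∨ α x ∈ l := by
  induction h with
  | nil => simp at hx
  | left h ih => grind
  | @right v l σ h ih =>
    have := hα v
    grind

theorem IsTransversal.notMem (hα : Function.Involutive α) {l : List V} {σ : Finset V}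
    (h : IsTransversal α l σ) {v : V} (hv : ∀ b ∈ l, b ≠ v ∧ b ≠ α v) : v ∉ σ ∧ α v ∉ σ := by
  have := hα v
  constructor
  · intro hs
    have := h.mem_of_mem hα hs
    grind
  · intro hs
    have := h.mem_of_mem hα hs
    grind

theorem IsTransversal.card_eq (hα : Function.Involutive α) {l : List V} {σ : Finset V}
    (h : IsTransversal α l σ) (hl : l.Pairwise fun a b => b ≠ a ∧ b ≠ α a) :
    σ.card = l.length := by
  induction h with
  | nil => rfl
  | left h ih =>
    rw [List.pairwise_cons] at hl
    rw [Finset.card_insert_of_notMem (h.notMem hα hl.1).1, ih hl.2, List.length_cons]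
  | right h ih =>
    rw [List.pairwise_cons] at hl
    rw [Finset.card_insert_of_notMem (h.notMem hα hl.1).2, ih hl.2, List.length_cons]

theorem IsTransversal.apply_notMem (hα : Function.Involutive α) (hne : ∀ a, α a ≠ a) {l : List V}
    {σ : Finset V} (h : IsTransversal α l σ) (hl : l.Pairwise fun a b => b ≠ a ∧ b ≠ α a) :
    ∀ a ∈ σ, α a ∉ σ := by
  induction h with
  | nil => simp
  | @left v l σ h ih =>
    rw [List.pairwise_cons] at hl
    have h1 := h.notMem hα hl.1
    have h2 := hne v
    have h3 := ih hl.2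
    intro a
    have := hα a
    grind
  | @right v l σ h ih =>
    rw [List.pairwise_cons] at hl
    have h1 := h.notMem hα hl.1
    have h2 := hne v
    have h3 := ih hl.2
    have h4 := hα v
    intro a
    have := hα a
    grind

/-- A set without `α`-pairs meets `{v, α v}` in at most one vertex, whose removal reduces to the
shorter list. If it misses the pair, the bound is strict. The bound gives the dimension of `K_J`,
the equality case its facets. -/
theorem card_le_and_isTransversal (hα : Function.Involutive α) {l : List V} {σ : Finset V}
    (hσl : ∀ x ∈ σ, x ∈ l ∨ α x ∈ l) (hσ : ∀ a ∈ σ, α a ∉ σ) :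
    σ.card ≤ l.length ∧ (σ.card = l.length → IsTransversal α l σ) := by
  induction l generalizing σ with
  | nil =>
    have : σ = ∅ := Finset.eq_empty_of_forall_notMem fun x hx => by simpa using hσl x hx
    subst this
    exact ⟨le_rfl, fun _ => .nil⟩
  | cons v l ih =>
    have key : ∀ u ∈ σ, u = v ∨ u = α v → (σ.erase u).card ≤ l.length ∧
        ((σ.erase u).card = l.length → IsTransversal α l (σ.erase u)) := by
      intro u hu huv
      refine ih (fun x hx => ?_) (fun a ha h => ?_)
      · have h1 := hσl x (Finset.mem_of_mem_erase hx)
        have h2 := Finset.ne_of_mem_erase hx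
        have h3 := hσ x (Finset.mem_of_mem_erase hx)
        have h4 := hα x
        grind
      · exact hσ a (Finset.mem_of_mem_erase ha) (Finset.mem_of_mem_erase h)
    by_cases h1 : v ∈ σ
    · have := key v h1 (Or.inl rfl)
      rw [← Finset.card_erase_add_one h1, List.length_cons]
      refine ⟨by omega, fun h => ?_⟩
      rw [← Finset.insert_erase h1]
      exact (this.2 (by omega)).left
    by_cases h2 : α v ∈ σ
    · have := key (α v) h2 (Or.inr rfl)
      rw [← Finset.card_erase_add_one h2, List.length_cons]
      refine ⟨by omega, fun h => ?_⟩
      rw [← Finset.insert_erase h2]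
      exact (this.2 (by omega)).right
    have := ih (σ := σ) (fun x hx => by
      have h1 := hσl x hx
      have h4 := hα x
      grind) hσ
    rw [List.length_cons]
    exact ⟨by omega, fun h => by omega⟩

end Transversal

/-! ### The fundamental cycle as a functional on functions of finite vertex sets -/

section Evaluation

variable {V : Type*} [LinearOrder V] {α : V → V} {k : Type*} [CommRing k]

variable (k) in
/-- The difference of the contractions of a cochain with the vertices `v` and `α v`. -/
def slice (α : V → V) (v : V) : (Finset V → k) →ₗ[k] (Finset V → k) where
  -- The sign `(-1) ^ pos σ v` moves `v` from the front of the oriented simplex to its sorted place.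
  toFun f σ := (-1) ^ pos σ v * f (insert v σ) - (-1) ^ pos σ (α v) * f (insert (α v) σ)
  map_add' f g := by
    funext σ
    simp only [Pi.add_apply]
    ring
  map_smul' c f := by
    funext σ
    simp only [Pi.smul_apply, smul_eq_mul, RingHom.id_apply]
    ring

theorem slice_apply (v : V) (f : Finset V → k) (σ : Finset V) : slice k α v f σ =
    (-1) ^ pos σ v * f (insert v σ) - (-1) ^ pos σ (α v) * f (insert (α v) σ) := rfl

variable (k) in
/-- Evaluation on the fundamental cycle of the cross-polytope with vertices `a` and `α a` for `a`
in a list. -/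
def fundEval (α : V → V) : List V → (Finset V → k) →ₗ[k] k
  | [] => LinearMap.proj ∅
  | v :: l => fundEval α l ∘ₗ slice k α v

theorem fundEval_nil (f : Finset V → k) : fundEval k α [] f = f ∅ := rfl

theorem fundEval_cons (v : V) (l : List V) (f : Finset V → k) :
    fundEval k α (v :: l) f = fundEval k α l (slice k α v f) := rfl

/-- The fundamental cycle is supported on transversals. Identities of cochains are thus needed only
there, where all the sets concerned are faces. -/
theorem fundEval_congr {l : List V} {f g : Finset V → k}
    (h : ∀ σ, IsTransversal α l σ → f σ = g σ) : fundEval k α l f = fundEval k α l g := by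
  induction l generalizing f g with
  | nil => exact h ∅ .nil
  | cons v l ih =>
    refine ih fun σ hσ => ?_
    rw [slice_apply, slice_apply, h _ hσ.left, h _ hσ.right]

theorem pos_insert_self {σ : Finset V} {v : V} (hv : v ∉ σ) : pos (insert v σ) v = pos σ v := by
  rw [pos_erase (Finset.mem_insert_self v σ), Finset.erase_insert hv]
  simp

/-- The coboundary of a function on all finite sets of vertices. -/
def coboundary (f : Finset V → k) (σ : Finset V) : k :=
  ∑ v ∈ σ, (-1) ^ pos σ v * f (σ.erase v)

/-- This is the homotopy formula for contraction with `v`: deleting `v` returns `f σ`, and deleting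
another vertex commutes with the contraction up to a sign. -/
theorem coboundary_insert (f : Finset V → k) {σ : Finset V} {v : V} (hv : v ∉ σ) :
    (-1) ^ pos σ v * coboundary f (insert v σ) =
      f σ - coboundary (fun τ => (-1) ^ pos τ v * f (insert v τ)) σ := by
  unfold coboundary
  rw [Finset.sum_insert hv, mul_add, pos_insert_self hv, Finset.erase_insert hv, ← mul_assoc,
    ← pow_add, Even.neg_one_pow ⟨_, rfl⟩, one_mul, sub_eq_add_neg, Finset.mul_sum,
    ← Finset.sum_neg_distrib]
  congr 1
  refine Finset.sum_congr rfl fun w hw => ?_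
  have hne : v ≠ w := fun h => hv (h ▸ hw)
  rw [Finset.erase_insert_of_ne hne, pos_erase hw v,
    pos_erase (Finset.mem_insert_self v σ) w, Finset.erase_insert hv]
  -- Exactly one of the two position counts, of `v` or of `w`, is shifted by one; hence the minus
  -- sign.
  rcases lt_or_gt_of_ne hne with h | h
  · simp only [h, h.not_gt, if_true, if_false, pow_add]
    ring
  · simp only [h, h.not_gt, if_true, if_false, pow_add]
    ring

/-- The term `f σ` of `coboundary_insert` does not depend on the vertex, so it cancels in the
difference: `[v] - [α v]` is a cycle in the augmented complex. -/
theorem slice_coboundary (f : Finset V → k) {σ : Finset V} {v : V} (hv : v ∉ σ) (hv' : α v ∉ σ) :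
    slice k α v (coboundary f) σ = (- coboundary (slice k α v f)) σ := by
  rw [slice_apply, coboundary_insert f hv, coboundary_insert f hv', Pi.neg_apply]
  simp only [coboundary, slice_apply, mul_sub, Finset.sum_sub_distrib]
  ring

/-- The coboundary passes through each slice with a sign until it is evaluated at `∅`, where it is
an empty sum. -/
theorem fundEval_coboundary (hα : Function.Involutive α) {l : List V}
    (hl : l.Pairwise fun a b => b ≠ a ∧ b ≠ α a) (f : Finset V → k) :
    fundEval k α l (coboundary f) = 0 := by
  induction l generalizing f with
  | nil => simp [fundEval_nil, coboundary]
  | cons v l ih =>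
    rw [List.pairwise_cons] at hl
    rw [fundEval_cons, fundEval_congr fun σ hσ => slice_coboundary f (hσ.notMem hα hl.1).1
      (hσ.notMem hα hl.1).2, map_neg, ih hl.2, neg_zero]

/-- The facet `l.toFinset` is reached only by choosing `v` rather than `α v` in every pair, so its
coefficient in the cycle is `±1`. -/
theorem isUnit_fundEval_single (hα : Function.Involutive α) (hne : ∀ a, α a ≠ a) {l : List V}
    (hl : l.Pairwise fun a b => b ≠ a ∧ b ≠ α a) :
    IsUnit (fundEval k α l (Pi.single l.toFinset 1)) := by
  induction l with
  | nil => simp [fundEval_nil]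
  | cons v l ih =>
    rw [List.pairwise_cons] at hl
    have hvl : v ∉ l.toFinset := fun h => (hl.1 v (by simpa using h)).1 rfl
    rw [fundEval_cons, fundEval_congr (g := (-1 : k) ^ pos l.toFinset v •
      (Pi.single l.toFinset 1 : Finset V → k)) fun σ hσ => ?_, map_smul, smul_eq_mul]
    · exact (isUnit_one.neg.pow _).mul (ih hl.2)
    · have h := hσ.notMem hα hl.1
      have h1 : insert (α v) σ ≠ insert v l.toFinset := fun e => by
        have : v ∈ insert (α v) σ := e ▸ Finset.mem_insert_self _ _
        rcases Finset.mem_insert.mp this with h' | h'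
        · exact hne v h'.symm
        · exact h.1 h'
      have h2 : insert v σ = insert v l.toFinset ↔ σ = l.toFinset :=
        ⟨fun e => by rw [← Finset.erase_insert h.1, e, Finset.erase_insert hvl],
          fun e => by rw [e]⟩
      rw [slice_apply, List.toFinset_cons, Pi.single_eq_of_ne h1, mul_zero, sub_zero,
        Pi.smul_apply, smul_eq_mul, Pi.single_apply, Pi.single_apply]
      by_cases e : σ = l.toFinset
      · simp [e]
      · simp [e, h2]

/-- The external product of functions on finite sets of vertices. -/
def crossFun (J L : Finset V) (f g : Finset V → k) (ρ : Finset V) : k :=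
  (-1) ^ inversions (ρ ∩ J) (ρ ∩ L) * (f (ρ ∩ J) * g (ρ ∩ L))

/-- Contraction with a vertex of `J` acts on the first factor alone: the vertices of `ρ ∩ L`
preceding `v` are exactly the inversions that `v` adds to the shuffle, and these two signs cancel.
-/
theorem crossFun_insert {J L : Finset V} (hJL : Disjoint J L) (f g : Finset V → k)
    {ρ : Finset V} (hρ : ρ ⊆ J ∪ L) {v : V} (hv : v ∈ J) (hvρ : v ∉ ρ) :
    (-1) ^ pos ρ v * crossFun J L f g (insert v ρ) =
      crossFun J L (fun σ => (-1) ^ pos σ v * f (insert v σ)) g ρ := by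
  have hvL : v ∉ L := Finset.disjoint_left.mp hJL hv
  have hvJ : v ∉ ρ ∩ J := fun h => hvρ (Finset.mem_inter.mp h).1
  have hpos : pos ρ v = pos (ρ ∩ J) v + pos (ρ ∩ L) v := by
    rw [← pos_union (hJL.mono Finset.inter_subset_right Finset.inter_subset_right),
      ← Finset.inter_union_distrib_left, Finset.inter_eq_left.mpr hρ]
  unfold crossFun
  rw [Finset.insert_inter_of_mem hv, Finset.insert_inter_of_notMem hvL,
    inversions_erase_left (Finset.mem_insert_self v _), Finset.erase_insert hvJ, hpos, pow_add,
    pow_add]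
  have h : ((-1 : k) ^ pos (ρ ∩ L) v) * (-1) ^ pos (ρ ∩ L) v = 1 := by
    rw [← pow_add, Even.neg_one_pow ⟨_, rfl⟩]
  linear_combination ((-1) ^ pos (ρ ∩ J) v * (-1) ^ inversions (ρ ∩ J) (ρ ∩ L) *
    (f (insert v (ρ ∩ J)) * g (ρ ∩ L))) * h

/-- The fundamental cycle of a join is the join of the fundamental cycles. Slices for `l` act on `f`
one at a time; once `l` is exhausted, `σ ∩ J` is empty, no inversions remain and `f ∅` is a scalar
factor. -/
theorem fundEval_crossFun (hα : Function.Involutive α) {J L : Finset V} (hJL : Disjoint J L)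
    {l m : List V} (hlm : (l ++ m).Pairwise fun a b => b ≠ a ∧ b ≠ α a)
    (hlJ : ∀ a ∈ l, a ∈ J ∧ α a ∈ J) (hmL : ∀ a ∈ m, a ∈ L ∧ α a ∈ L) (f g : Finset V → k) :
    fundEval k α (l ++ m) (crossFun J L f g) = fundEval k α l f * fundEval k α m g := by
  have hmem : ∀ {m : List V} {L : Finset V} {σ}, (∀ a ∈ m, a ∈ L ∧ α a ∈ L) →
      IsTransversal α m σ → σ ⊆ L := fun {m L σ} hmL hσ x hx => by
    rcases hσ.mem_of_mem hα hx with h | h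
    · exact (hmL x h).1
    · simpa [hα x] using (hmL _ h).2
  induction l generalizing f with
  | nil =>
    rw [List.nil_append, fundEval_nil, ← smul_eq_mul, ← map_smul]
    refine fundEval_congr fun σ hσ => ?_
    have h1 := hmem hmL hσ
    have h2 : σ ∩ J = ∅ := Finset.disjoint_iff_inter_eq_empty.mp (hJL.symm.mono_left h1)
    simp [crossFun, h2, Finset.inter_eq_left.mpr h1, inversions]
  | cons v l ih =>
    rw [List.cons_append, List.pairwise_cons] at hlm
    rw [List.cons_append, fundEval_cons, fundEval_cons,
      ← ih hlm.2 (fun a ha => hlJ a (List.mem_cons_of_mem v ha))]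
    refine fundEval_congr fun ρ hρ => ?_
    have hv := hlJ v List.mem_cons_self
    have hv' := hρ.notMem hα hlm.1
    have hsub : ρ ⊆ J ∪ L := hmem (fun a ha => by
      rcases List.mem_append.mp ha with h | h
      · have := hlJ a (List.mem_cons_of_mem v h)
        exact ⟨Finset.mem_union_left _ this.1, Finset.mem_union_left _ this.2⟩
      · exact ⟨Finset.mem_union_right _ (hmL a h).1, Finset.mem_union_right _ (hmL a h).2⟩) hρ
    rw [slice_apply, crossFun_insert hJL f g hsub hv.1 hv'.1,
      crossFun_insert hJL f g hsub hv.2 hv'.2]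
    simp only [crossFun, slice_apply]
    ring

end Evaluation

/-! ### Evaluation on the fundamental cycle as an isomorphism in top degree -/

section TopCohomology

variable {V : Type*} [LinearOrder V] {k : Type*} [CommRing k]

variable (k) in
/-- Extension of cochains by zero to all finite sets of vertices. -/
def extendZero (K : PreAbstractSimplicialComplex V) : Cochain k K →ₗ[k] (Finset V → k) :=
  open Classical in
  { toFun := fun φ σ => if h : σ = ∅ ∨ σ ∈ K.faces then φ ⟨σ, h⟩ else 0
    map_add' := fun φ ψ => by
      funext σ
      simp only [Pi.add_apply]
      split_ifs <;> simp
    map_smul' := fun c φ => by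
      funext σ
      simp only [Pi.smul_apply, RingHom.id_apply]
      split_ifs <;> simp }

theorem extendZero_apply {K : PreAbstractSimplicialComplex V} (φ : Cochain k K) (σ : AugFace K) :
    extendZero k K φ σ.1 = φ σ := dif_pos σ.2

/-- The identity is restricted to faces: off the faces the left side is zero, while the coboundary
of the extension need not be. -/
theorem extendZero_d {K : PreAbstractSimplicialComplex V} (φ : Cochain k K) (σ : AugFace K) :
    extendZero k K (d k K φ) σ.1 = coboundary (extendZero k K φ) σ.1 := by
  rw [extendZero_apply]
  refine Finset.sum_congr rfl fun v _ => ?_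
  rw [← extendZero_apply φ (σ.erase v)]
  rfl

variable {α : V → V} {K : PreAbstractSimplicialComplex V} {J L : Finset V} {l m : List V}

theorem IsCrossPolytopal.aug_full_iff (hK : IsCrossPolytopal K α) {σ : Finset V} :
    (σ = ∅ ∨ σ ∈ (full K J).faces) ↔ (∀ a ∈ σ, α a ∉ σ) ∧ σ ⊆ J := by
  rw [VRCube.aug_full_iff, hK.mem_faces]
  refine and_congr_left fun _ => ?_
  rcases σ.eq_empty_or_nonempty with rfl | h
  · simp
  · simp [h, h.ne_empty]

theorem IsCrossPolytopal.aug_of_isTransversal (hK : IsCrossPolytopal K α) (hl : IsSection α J l)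
    {σ : Finset V} (hσ : IsTransversal α l σ) : σ = ∅ ∨ σ ∈ (full K J).faces :=
  hK.aug_full_iff.mpr ⟨hσ.apply_notMem hK.involutive hK.apply_ne hl.pairwise, fun x hx =>
    (hl.mem_iff x).mpr (hσ.mem_of_mem hK.involutive hx)⟩

theorem IsCrossPolytopal.card_le (hK : IsCrossPolytopal K α) (hl : IsSection α J l)
    (σ : AugFace (full K J)) : σ.1.card ≤ l.length :=
  have h := hK.aug_full_iff.mp σ.2
  (card_le_and_isTransversal hK.involutive (fun x hx => (hl.mem_iff x).mp (h.2 hx)) h.1).1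

theorem IsCrossPolytopal.isTransversal (hK : IsCrossPolytopal K α) (hl : IsSection α J l)
    (σ : AugFace (full K J)) (hσ : σ.1.card = l.length) : IsTransversal α l σ.1 :=
  have h := hK.aug_full_iff.mp σ.2
  (card_le_and_isTransversal hK.involutive (fun x hx => (hl.mem_iff x).mp (h.2 hx)) h.1).2 hσ

/-- These cochains have top degree: a simplex on which the coboundary could be nonzero would have
`l.length + 1` vertices. -/
theorem IsCrossPolytopal.homogeneous_le_cocycles (hK : IsCrossPolytopal K α)
    (hl : IsSection α J l) : homogeneous k (full K J) l.length ≤ cocycles k (full K J) l.length := by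
  refine fun φ hφ => ⟨hφ, LinearMap.mem_ker.mpr (funext fun σ => Finset.sum_eq_zero fun v hv => ?_)⟩
  have h1 := hK.card_le hl σ
  have h2 : (σ.erase v).1.card + 1 = σ.1.card := Finset.card_erase_add_one hv
  rw [hφ (σ.erase v) (by omega), mul_zero]

theorem IsCrossPolytopal.fundEval_coboundaries (hK : IsCrossPolytopal K α) (hl : IsSection α J l)
    (q : ℕ) {φ : Cochain k (full K J)} (hφ : φ ∈ coboundaries k (full K J) q) :
    fundEval k α l (extendZero k (full K J) φ) = 0 := by
  cases q with
  | zero => rw [show φ = 0 from hφ, map_zero, map_zero]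
  | succ q =>
    obtain ⟨η, -, rfl⟩ := hφ
    rw [fundEval_congr fun σ hσ => extendZero_d η ⟨σ, hK.aug_of_isTransversal hl hσ⟩,
      fundEval_coboundary hK.involutive hl.pairwise]

/-- Replacing a vertex of a top simplex by its antipode changes the dual cochain only by a sign and
a coboundary. -/
theorem IsCrossPolytopal.d_single (hK : IsCrossPolytopal K α) (hl : IsSection α J l)
    {σ τ ρ : AugFace (full K J)} {w : V} (hw : w ∈ σ.1) (hσ : σ.1.card = l.length)
    (hτ : τ.1 = σ.1.erase w) (hρ : ρ.1 = insert (α w) τ.1) [DecidableEq (AugFace (full K J))] :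
    d k (full K J) (Pi.single τ 1) =
      (-1 : k) ^ pos σ.1 w • Pi.single σ 1 + (-1 : k) ^ pos ρ.1 (α w) • Pi.single ρ 1 := by
  have hα := hK.involutive
  have hwτ : w ∉ τ.1 := by simp [hτ]
  have hwτ' : α w ∉ τ.1 := fun h => (hK.aug_full_iff.mp σ.2).1 w hw
    (Finset.mem_of_mem_erase (hτ ▸ h))
  have hστ : σ.1 = insert w τ.1 := by rw [hτ, Finset.insert_erase hw]
  -- The value of the coboundary on any simplex obtained from `τ` by adding one vertex; it will be
  -- used for `σ` and `ρ`.
  have hsum : ∀ (ω : AugFace (full K J)) (u : V), u ∉ τ.1 → ω.1 = insert u τ.1 →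
      d k (full K J) (Pi.single τ 1) ω = (-1 : k) ^ pos ω.1 u := fun ω u hu hω => by
    have hu' : u ∈ ω.1 := by simp [hω]
    refine (Finset.sum_eq_single_of_mem u hu' fun x hx hxu => ?_).trans ?_
    · rw [Pi.single_eq_of_ne, mul_zero]
      intro e
      have : u ∈ (ω.erase x).1 := Finset.mem_erase.mpr ⟨hxu.symm, hu'⟩
      exact hu (e ▸ this)
    · rw [show ω.erase u = τ from Subtype.ext (by
        change ω.1.erase u = _
        rw [hω, Finset.erase_insert hu]), Pi.single_eq_same, mul_one]
  have hne : σ ≠ ρ := fun e => by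
    have : w ∈ insert (α w) τ.1 := hρ ▸ e ▸ hw
    rcases Finset.mem_insert.mp this with h | h
    · exact hK.apply_ne w h.symm
    · exact hwτ h
  funext ω
  simp only [Pi.add_apply, Pi.smul_apply, smul_eq_mul]
  by_cases h1 : ω = σ
  · subst h1
    rw [hsum ω w hwτ hστ, Pi.single_eq_same, Pi.single_eq_of_ne hne]
    ring
  by_cases h2 : ω = ρ
  · subst h2
    rw [hsum ω (α w) hwτ' hρ, Pi.single_eq_same, Pi.single_eq_of_ne hne.symm]
    ring
  rw [Pi.single_eq_of_ne h1, Pi.single_eq_of_ne h2, mul_zero, mul_zero, add_zero]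
  -- Any simplex `ω` with `τ` as a codimension-one face is a facet, so it contains `w` or `α w` and
  -- must be `σ` or `ρ`.
  refine Finset.sum_eq_zero fun u hu => ?_
  rw [Pi.single_eq_of_ne, mul_zero]
  intro e
  have hωτ : ω.1 = insert u τ.1 := by
    rw [← e]
    exact (Finset.insert_erase hu).symm
  have huτ : u ∉ τ.1 := by
    rw [← e]
    exact Finset.notMem_erase u ω.1
  have hcard : ω.1.card = l.length := by
    rw [← hσ, hωτ, hστ, Finset.card_insert_of_notMem huτ, Finset.card_insert_of_notMem hwτ]
  have hT := hK.isTransversal hl ω hcard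
  have hww : w ∈ ω.1 ∨ α w ∈ ω.1 := by
    rcases (hl.mem_iff w).mp ((hK.aug_full_iff.mp σ.2).2 hw) with h | h
    · exact hT.mem_or h
    · have := hT.mem_or h
      rw [hα w] at this
      exact this.symm
  rw [hωτ, Finset.mem_insert, Finset.mem_insert] at hww
  rcases hww with (h | h) | (h | h)
  · exact h1 (Subtype.ext (by rw [hωτ, hστ, h]))
  · exact hwτ h
  · exact h2 (Subtype.ext (by rw [hωτ, hρ, h]))
  · exact hwτ' h

theorem isTransversal_toFinset (l : List V) : IsTransversal α l l.toFinset := by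
  induction l with
  | nil => exact .nil
  | cons v l ih =>
    rw [List.toFinset_cons]
    exact ih.left

/-- A walk through adjacent facets: each step replaces a vertex outside `l` by its antipode in `l`,
so `σ.1 \ l.toFinset` shrinks until `σ₀` is reached. -/
theorem IsCrossPolytopal.single_mem (hK : IsCrossPolytopal K α) (hl : IsSection α J l)
    [DecidableEq (AugFace (full K J))] (σ₀ : AugFace (full K J)) (hσ₀ : σ₀.1 = l.toFinset)
    (σ : AugFace (full K J)) (hσ : σ.1.card = l.length) :
    (Pi.single σ 1 : Cochain k (full K J)) ∈
      Submodule.span k {Pi.single σ₀ 1} ⊔ coboundaries k (full K J) l.length := by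
  induction hn : (σ.1 \ l.toFinset).card generalizing σ with
  | zero =>
    rw [Finset.card_eq_zero, Finset.sdiff_eq_empty_iff_subset] at hn
    have : σ = σ₀ := Subtype.ext <| by
      rw [hσ₀]
      refine Finset.eq_of_subset_of_card_le hn ?_
      rw [hσ]
      exact List.toFinset_card_le l
    rw [this]
    exact Submodule.mem_sup_left (Submodule.mem_span_singleton_self _)
  | succ n ih =>
    obtain ⟨w, hw⟩ := Finset.card_pos.mp (by omega : 0 < (σ.1 \ l.toFinset).card)
    obtain ⟨hwσ, hwl⟩ := Finset.mem_sdiff.mp hw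
    have hf := hK.aug_full_iff.mp σ.2
    have hαl : α w ∈ l := ((hl.mem_iff w).mp (hf.2 hwσ)).resolve_left (by simpa using hwl)
    let τ : AugFace (full K J) := σ.erase w
    have hαw : α w ∉ σ.1.erase w := fun h => hf.1 w hwσ (Finset.mem_of_mem_erase h)
    have hρ : insert (α w) τ.1 = ∅ ∨ insert (α w) τ.1 ∈ (full K J).faces := by
      have hα := hK.involutive
      refine hK.aug_full_iff.mpr ⟨fun a ha => ?_, Finset.insert_subset
        ((hl.mem_iff _).mpr (Or.inl hαl)) ((Finset.erase_subset _ _).trans hf.2)⟩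
      change a ∈ insert (α w) (σ.1.erase w) at ha
      change α a ∉ insert (α w) (σ.1.erase w)
      rw [Finset.mem_insert] at ha ⊢
      rintro (h | h)
      · have haw := hα.injective h
        rcases ha with e | e
        · exact hK.apply_ne w (e.symm.trans haw)
        · exact (Finset.notMem_erase w σ.1) (haw ▸ e)
      · rcases ha with e | e
        · rw [e, hα w] at h
          exact Finset.notMem_erase w σ.1 h
        · exact hf.1 a (Finset.mem_of_mem_erase e) (Finset.mem_of_mem_erase h)
    let ρ : AugFace (full K J) := ⟨insert (α w) τ.1, hρ⟩
    have hcτ : τ.1.card + 1 = l.length := by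
      rw [← hσ]
      exact Finset.card_erase_add_one hwσ
    have hρm := ih ρ ((Finset.card_insert_of_notMem hαw).trans hcτ) (by
      have : ρ.1 \ l.toFinset = (σ.1 \ l.toFinset).erase w := by
        change insert (α w) (σ.1.erase w) \ l.toFinset = _
        rw [Finset.insert_sdiff_of_mem _ (by simpa using hαl), Finset.erase_sdiff_comm]
      rw [this, Finset.card_erase_of_mem hw, hn, Nat.add_sub_cancel])
    have hd := hK.d_single (k := k) hl (ρ := ρ) hwσ hσ (τ := τ) rfl rfl
    have hB : d k (full K J) (Pi.single τ 1) ∈ coboundaries k (full K J) l.length := by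
      rw [← hcτ]
      exact ⟨_, fun ω hω => Pi.single_eq_of_ne (fun e : ω = τ => hω (e ▸ rfl)) _, rfl⟩
    -- The relation `d_single` solved for the dual cochain of `σ`; the sign is its own inverse.
    have hs : (Pi.single σ 1 : Cochain k (full K J)) = (-1 : k) ^ pos σ.1 w •
        (d k (full K J) (Pi.single τ 1) - (-1 : k) ^ pos ρ.1 (α w) • Pi.single ρ 1) := by
      rw [hd, add_sub_cancel_right, smul_smul, ← pow_add, Even.neg_one_pow ⟨_, rfl⟩, one_smul]
    rw [hs]
    exact Submodule.smul_mem _ _ (Submodule.sub_mem _ (Submodule.mem_sup_right hB)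
      (Submodule.smul_mem _ _ hρm))

variable (k) in
/-- Evaluation of top cohomology classes on the fundamental cycle. -/
def topEval (hK : IsCrossPolytopal K α) (hl : IsSection α J l) (q : ℕ) :
    RedH k (full K J) q →ₗ[k] k :=
  Submodule.liftQ _ (fundEval k α l ∘ₗ extendZero k (full K J) ∘ₗ Submodule.subtype _)
    fun _ hφ => hK.fundEval_coboundaries hl q hφ

theorem topEval_mk (hK : IsCrossPolytopal K α) (hl : IsSection α J l) (q : ℕ)
    (φ : cocycles k (full K J) q) : topEval k hK hl q (Submodule.Quotient.mk φ) =
      fundEval k α l (extendZero k (full K J) φ.1) := rfl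

/-- Top cohomology is generated by the dual class of the single facet `σ₀`, on which the evaluation
is a unit. The degree `q` is kept separate from `l.length` so that `l ++ m` can be used in degree
`l.length + m.length`. -/
theorem topEval_bijective [Finite V] (hK : IsCrossPolytopal K α) (hl : IsSection α J l) {q : ℕ}
    (hq : l.length = q) : Function.Bijective (topEval k hK hl q) := by
  classical
  subst hq
  let σ₀ : AugFace (full K J) :=
    ⟨l.toFinset, hK.aug_of_isTransversal hl (isTransversal_toFinset l)⟩
  have hσ₀ : σ₀.1.card = l.length :=
    (isTransversal_toFinset l).card_eq hK.involutive hl.pairwise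
  have hu : IsUnit (fundEval k α l (extendZero k (full K J) (Pi.single σ₀ 1))) := by
    rw [fundEval_congr (g := Pi.single l.toFinset 1) fun σ hσ => ?_]
    · exact isUnit_fundEval_single hK.involutive hK.apply_ne hl.pairwise
    · rw [extendZero_apply _ ⟨σ, hK.aug_of_isTransversal hl hσ⟩, Pi.single_apply, Pi.single_apply]
      exact if_congr Subtype.ext_iff rfl rfl
  have hspan : ∀ φ ∈ homogeneous k (full K J) l.length,
      φ ∈ Submodule.span k {Pi.single σ₀ 1} ⊔ coboundaries k (full K J) l.length := by
    intro φ hφ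
    -- Finiteness of `V` makes every cochain a finite sum of multiples of dual cochains.
    have := Fintype.ofFinite (AugFace (full K J))
    rw [← Finset.univ_sum_single φ]
    refine Submodule.sum_mem _ fun σ _ => ?_
    by_cases hσ : σ.1.card = l.length
    · have := Submodule.smul_mem _ (φ σ) (hK.single_mem (k := k) hl σ₀ rfl σ hσ)
      rwa [← Pi.single_smul, smul_eq_mul, mul_one] at this
    · rw [hφ σ hσ, Pi.single_zero]
      exact Submodule.zero_mem _
  constructor
  · rw [injective_iff_map_eq_zero]
    intro a ha
    induction a using Submodule.Quotient.induction_on with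
    | H φ =>
      rw [topEval_mk] at ha
      obtain ⟨x, hx, b, hb, e⟩ := Submodule.mem_sup.mp (hspan φ.1 φ.2.1)
      obtain ⟨c, rfl⟩ := Submodule.mem_span_singleton.mp hx
      rw [← e, map_add, map_add, hK.fundEval_coboundaries hl _ hb, add_zero, map_smul, map_smul,
        smul_eq_mul, hu.mul_left_eq_zero] at ha
      rw [ha, zero_smul, zero_add] at e
      exact (Submodule.Quotient.mk_eq_zero _).mpr (show φ.1 ∈ _ from e ▸ hb)
  · intro c
    obtain ⟨u, hu⟩ := hu
    have hh : (Pi.single σ₀ 1 : Cochain k (full K J)) ∈ homogeneous k (full K J) l.length :=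
      fun ω hω => Pi.single_eq_of_ne (fun e : ω = σ₀ => hω (e ▸ hσ₀)) _
    refine ⟨Submodule.Quotient.mk ((c * ↑u⁻¹) • ⟨_, hK.homogeneous_le_cocycles hl hh⟩), ?_⟩
    rw [Submodule.Quotient.mk_smul, map_smul, topEval_mk, ← hu, smul_eq_mul,
      Units.inv_mul_cancel_right]

theorem IsSection.append (hα : Function.Involutive α) (hJL : Disjoint J L) (hl : IsSection α J l)
    (hm : IsSection α L m) : IsSection α (J ∪ L) (l ++ m) where
  pairwise := by
    refine List.pairwise_append.mpr ⟨hl.pairwise, hm.pairwise, fun a ha b hb => ?_⟩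
    have hbL : b ∈ L := (hm.mem_iff b).mpr (Or.inl hb)
    refine ⟨fun e => ?_, fun e => ?_⟩
    · exact Finset.disjoint_right.mp hJL hbL ((hl.mem_iff b).mpr (Or.inl (e ▸ ha)))
    · exact Finset.disjoint_right.mp hJL hbL ((hl.mem_iff b).mpr (Or.inr (by rwa [e, hα a])))
  mem_iff x := by
    rw [Finset.mem_union, hl.mem_iff, hm.mem_iff, List.mem_append, List.mem_append]
    tauto

theorem IsSection.mem_and_mem (hα : Function.Involutive α) (hl : IsSection α J l) {a : V}
    (ha : a ∈ l) : a ∈ J ∧ α a ∈ J :=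
  ⟨(hl.mem_iff a).mpr (Or.inl ha), (hl.mem_iff _).mpr (Or.inr (by rwa [hα a]))⟩

/-- On transversals of `l ++ m`, which are simplices of `K_{J ∪ L}`, the restricted external product
agrees with `crossFun` of the extensions by zero; so `fundEval_crossFun` descends to cohomology. -/
theorem topEval_star (hK : IsCrossPolytopal K α) (hJL : Disjoint J L) (hl : IsSection α J l)
    (hm : IsSection α L m) (p q : ℕ) (a : RedH k (full K J) p) (b : RedH k (full K L) q) :
    topEval k hK (hl.append hK.involutive hJL hm) (p + q) (star k K J L hJL p q a b) =
      topEval k hK hl p a * topEval k hK hm q b := by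
  have hlm := hl.append hK.involutive hJL hm
  induction a using Submodule.Quotient.induction_on with
  | H φ =>
    induction b using Submodule.Quotient.induction_on with
    | H ψ =>
      rw [topEval_mk, topEval_mk, ← fundEval_crossFun hK.involutive hJL hlm.pairwise
        (fun a => hl.mem_and_mem hK.involutive) (fun a => hm.mem_and_mem hK.involutive)]
      change fundEval k α (l ++ m) (extendZero k (full K (J ∪ L))
        (restrict k (full_union_le_join K J L) (cross k K J L hJL φ.1 ψ.1))) = _
      refine fundEval_congr fun ρ hρ => ?_
      have hρ' := hK.aug_of_isTransversal hlm hρ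
      have hj : ρ = ∅ ∨ ρ ∈ (join (full K J) (full K L)).faces :=
        hρ'.imp id fun h => full_union_le_join K J L h
      rw [extendZero_apply _ ⟨ρ, hρ'⟩]
      change (-1 : k) ^ inversions (ρ ∩ J) (ρ ∩ L) *
        (φ.1 ⟨ρ ∩ J, join_inter_left K J L hJL hj⟩ * ψ.1 ⟨ρ ∩ L, join_inter_right K J L hJL hj⟩) = _
      rw [← extendZero_apply φ.1, ← extendZero_apply ψ.1]
      rfl

theorem exists_equiv_suspStar [Finite V] (hK : IsCrossPolytopal K α) (hJL : Disjoint J L)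
    (hl : IsSection α J l) (hm : IsSection α L m) :
    ∃ (eJ : SuspH k (full K J) l.length ≃ₗ[k] k) (eL : SuspH k (full K L) m.length ≃ₗ[k] k)
      (eJL : SuspH k (full K (J ∪ L)) (l.length + m.length) ≃ₗ[k] k),
      ∀ a b, eJL (suspStar k K J L hJL l.length m.length a b) = eJ a * eL b := by
  refine ⟨(suspEquiv k _ _).symm ≪≫ₗ .ofBijective _ (topEval_bijective hK hl rfl),
    (suspEquiv k _ _).symm ≪≫ₗ .ofBijective _ (topEval_bijective hK hm rfl),
    (suspEquiv k _ _).symm ≪≫ₗ .ofBijective _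
      (topEval_bijective hK (hl.append hK.involutive hJL hm) List.length_append), fun a b => ?_⟩
  simp only [LinearEquiv.trans_apply, LinearEquiv.ofBijective_apply]
  rw [← topEval_star hK hJL hl hm]
  congr 1
  -- The outer suspension isomorphism in `suspStar` cancels against the desuspension in the third
  -- isomorphism.
  exact (suspEquiv k _ _).symm_apply_apply _

theorem IsAntipodalUnion.exists_isSection {n j : ℕ} {J : Finset (Q n)}
    (h : IsAntipodalUnion J j) : ∃ l : List (Q n), l.length = j ∧ IsSection antipode J l := by
  obtain ⟨v, hv, hJ⟩ := h
  obtain ⟨h1, -, h3⟩ := Sum.elim_injective.mp hv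
  refine ⟨List.ofFn v, List.length_ofFn, ⟨?_, fun x => ?_⟩⟩
  · rw [List.pairwise_ofFn]
    exact fun i i' hlt => ⟨fun e => hlt.ne' (h1 e), h3 _ _⟩
  · simp only [hJ, List.mem_ofFn, ← exists_or]
    refine exists_congr fun i => or_congr eq_comm ⟨fun e => ?_, fun e => ?_⟩
    · rw [e, antipode_involutive]
    · rw [e, antipode_involutive]

end TopCohomology

end VRCube

end

/-! ### The three statements for the hypercube -/

theorem mainTheorem8 (r : ℕ) (k : Type*) [CommRing k] :
    (∀ (J : Finset (VRCube.Q (r + 1))) (j : ℕ), VRCube.IsAntipodalUnion J j →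
      Nonempty (ContinuousMap.HomotopyEquiv
        (VRCube.Suspension (VRCube.Realization (VRCube.full (VRCube.VR (r + 1) r) J))) (VRCube.Sphere j))) ∧
    (∀ J : Finset (VRCube.Q (r + 1)), (¬ ∃ j, VRCube.IsAntipodalUnion J j) →
      ContractibleSpace (VRCube.Suspension (VRCube.Realization (VRCube.full (VRCube.VR (r + 1) r) J)))) ∧
    (∀ (J L : Finset (VRCube.Q (r + 1))) (j s : ℕ) (hJL : Disjoint J L),
      VRCube.IsAntipodalUnion J j → VRCube.IsAntipodalUnion L s →
      ∃ (eJ : VRCube.SuspH k (VRCube.full (VRCube.VR (r + 1) r) J) j ≃ₗ[k] k)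
        (eL : VRCube.SuspH k (VRCube.full (VRCube.VR (r + 1) r) L) s ≃ₗ[k] k)
        (eJL : VRCube.SuspH k (VRCube.full (VRCube.VR (r + 1) r) (J ∪ L)) (j + s) ≃ₗ[k] k),
        ∀ a b, eJL (VRCube.suspStar k (VRCube.VR (r + 1) r) J L hJL j s a b) = eJ a * eL b) := by
  have hK := VRCube.isCrossPolytopal_VR r
  refine ⟨fun J j hJ => ?_, fun J hJ => ?_, fun J L j s hJL hJ hL => ?_⟩
  · obtain ⟨v, hv, hJ⟩ := hJ
    exact (hK.suspension_homeomorph_sphere hv hJ).map Homeomorph.toHomotopyEquiv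
  · have h : ¬ ∀ a ∈ J, VRCube.antipode a ∈ J := fun h =>
      hJ (VRCube.isAntipodalUnion_of_antipode_mem hK.apply_ne h)
    push Not at h
    obtain ⟨a, ha, ha'⟩ := h
    have := hK.contractibleSpace_realization ha ha'
    exact VRCube.Suspension.contractibleSpace
  · obtain ⟨l, rfl, hl⟩ := hJ.exists_isSection
    obtain ⟨m, rfl, hm⟩ := hL.exists_isSection
    exact VRCube.exists_equiv_suspStar hK hJL hl hm
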